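/- Let $\alpha\ge 0$, $\rho\in(0,1)$, $\theta\in(\alpha,\min\{\rho,1/2\})$ and $\mu_*=\min\{\rho,1-\rho\}$. Let $W$ be a continuous, symmetric function on $(0,\infty)^2$, homogeneous of degree zero, with $0\le W(x,y)\le (x/y)^{\alpha}+(y/x)^{\alpha}$. For a kernel $K\ge 0$, a self-similar profile (with tail exponent $\rho$ and moment exponent $\beta\in[0,\rho)$) is a non-negative $f\in L^1_{\mathrm{loc}}((0,\infty))$, $f\not\equiv 0$, with $xf(x)\in L^1_{\mathrm{loc}}([0,\infty))$ and $\int_1^\infty x^{\beta}f(x)\,dx<\infty$, such that for almost every $x>0$ $$x^2f(x)=(1-\rho)\int_0^x yf(y)\,dy+\int_0^x\int_{x-y}^\infty yK(y,z)f(y)f(z)\,dz\,dy .$$ It is normalised if $$\int_0^R yf(y)\,dy\le \frac{\rho^2}{\Gamma(2-\rho)}R^{1-\rho}\ \text{ for all } R>0\quad\text{and}\quad \int_0^R yf(y)\,dy\sim \frac{\rho^2}{\Gamma(2-\rho)}R^{1-\rho}\ \text{ as } R\to\infty .$$ Let $\bar f$ be the (up to null sets unique) normalised self-similar profile for the constant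 kernel $K=2$ (with $\beta=0$). Write $(\mathcal Tg)(q)=\int_0^\infty g(x)e^{-qx}\,dx$, and, for $G\in C^2((0,\infty))\cap C([0,\infty))$, $$\|G\|_{2,\mu,\theta}=\sup_{q>0}(1+q)^{\theta}|G(q)|+\sum_{\ell=1}^{2}\sup_{q>0}(1+q)^{\theta+\mu+\rho}q^{\ell-\rho-\mu}|\partial_q^{\ell}G(q)| .$$ Then for every $\mu\in[0,\mu_*)$ and every $\delta>0$ there is $\varepsilon_0>0$ such that, for every $\varepsilon\in(0,\varepsilon_0]$ and every normalised self-similar profile $f$ for the kernel $K=2+\varepsilon W$ (with $\beta=\alpha$): $f$ and $\bar f$ are integrable on $(0,\infty)$, $\mathcal T(f-\bar f)\in C^2((0,\infty))\cap C([0,\infty))$ has finite norm $\|\cdot\|_{2,\mu,\theta}$, and $$\|\mathcal T(f-\bar f)\|_{2,\mu,\theta}\le\delta .$$ -/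

import Mathlib

open MeasureTheory Set Filter

open scoped ENNReal

namespace Smoluchowski

noncomputable section

/-- The perturbation kernels `W`: continuous, symmetric and homogeneous of degree zero on
`(0,∞) × (0,∞)`, with `0 ≤ W(x,y) ≤ (x/y)^α + (y/x)^α`. Values outside of `(0,∞) × (0,∞)` are
irrelevant. -/
structure IsPerturbationKernel (α : ℝ) (W : ℝ → ℝ → ℝ) : Prop where
  continuousOn : ContinuousOn (Function.uncurry W) (Ioi 0 ×ˢ Ioi 0)
  symm : ∀ x y : ℝ, 0 < x → 0 < y → W x y = W y x
  homogeneous : ∀ l x y : ℝ, 0 < l → 0 < x → 0 < y → W (l * x) (l * y) = W x y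
  nonneg : ∀ x y : ℝ, 0 < x → 0 < y → 0 ≤ W x y
  le_bound : ∀ x y : ℝ, 0 < x → 0 < y → W x y ≤ (x / y) ^ α + (y / x) ^ α

/-- The coagulation kernel `K = 2 + ε W`. -/
def coagulationKernel (ε : ℝ) (W : ℝ → ℝ → ℝ) (x y : ℝ) : ℝ := 2 + ε * W x y

/-- The constant coagulation kernel `K = 2`. -/
def constantKernel (_x _y : ℝ) : ℝ := 2

/-- The equation for self-similar profiles,
`x² f(x) = (1-ρ) ∫_0^x y f(y) dy + ∫_0^x ∫_{x-y}^∞ y K(y,z) f(y) f(z) dz dy`,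
at the point `x`. It is used for `0 < x`, `ρ < 1` and nonnegative `f` and `K` only, and the integrals
are integrals of nonnegative functions with values in `[0,∞]`, so that the equation also says that
they are finite. -/
def SatisfiesProfileEquationAt (ρ : ℝ) (K : ℝ → ℝ → ℝ) (f : ℝ → ℝ) (x : ℝ) : Prop :=
  ENNReal.ofReal (x ^ 2 * f x) =
    ENNReal.ofReal (1 - ρ) * (∫⁻ y in Ioo 0 x, ENNReal.ofReal (y * f y)) +
      ∫⁻ y in Ioo 0 x, ∫⁻ z in Ioi (x - y), ENNReal.ofReal (y * K y z * f y * f z)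

/-- Self-similar profiles `f ∈ L¹_loc((0,∞))` for the kernel `K`; `f` is taken modulo null sets and
its values on `(-∞,0]` are irrelevant. -/
structure IsSelfSimilarProfile (ρ α : ℝ) (K : ℝ → ℝ → ℝ) (f : ℝ → ℝ) : Prop where
  locallyIntegrableOn : LocallyIntegrableOn f (Ioi 0)
  nonneg : ∀ᵐ x ∂(volume.restrict (Ioi (0 : ℝ))), 0 ≤ f x
  ne_zero : ¬ ∀ᵐ x ∂(volume.restrict (Ioi (0 : ℝ))), f x = 0
  equation : ∀ᵐ x ∂(volume.restrict (Ioi (0 : ℝ))), SatisfiesProfileEquationAt ρ K f x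
  locallyIntegrableOn_mul : LocallyIntegrableOn (fun x => x * f x) (Ici 0)
  moment : IntegrableOn (fun x => x ^ α * f x) (Ioi 1)

/-- The normalisation of the tail at infinity: `∫_0^R y f(y) dy` is bounded by, and for `R → ∞`
asymptotically equivalent to, `ρ² / Γ(2-ρ) * R^(1-ρ)`. -/
structure IsNormalised (ρ : ℝ) (f : ℝ → ℝ) : Prop where
  le : ∀ R : ℝ, 0 < R →
    ∫ y in Ioo 0 R, y * f y ≤ ρ ^ 2 / Real.Gamma (2 - ρ) * R ^ (1 - ρ)
  isEquivalent : Asymptotics.IsEquivalent atTop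
    (fun R : ℝ => ∫ y in Ioo 0 R, y * f y)
    (fun R : ℝ => ρ ^ 2 / Real.Gamma (2 - ρ) * R ^ (1 - ρ))

/-- The Laplace transform `(T g)(q) = ∫_0^∞ g(x) e^{-qx} dx`. -/
def laplace (g : ℝ → ℝ) (q : ℝ) : ℝ := ∫ x in Ioi (0 : ℝ), g x * Real.exp (-(q * x))

/-- The seminorm `[G]_{k,μ,χ} = sup_{q>0} (1+q)^(χ+μ+ρ) q^(k-ρ-μ) |∂^k G(q)|`, with values in
`[0,∞]`. -/
def seminorm (ρ : ℝ) (k : ℕ) (μ χ : ℝ) (G : ℝ → ℝ) : ℝ≥0∞ :=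
  ⨆ (q : ℝ) (_ : 0 < q),
    ENNReal.ofReal ((1 + q) ^ (χ + μ + ρ) * q ^ ((k : ℝ) - ρ - μ) * |iteratedDeriv k G q|)

/-- The norm `‖G‖_{k,μ,χ} = [G]_{0,-ρ,χ} + ∑_{ℓ=1}^k [G]_{ℓ,μ,χ}` (for `k = 1, 2`), with values in
`[0,∞]`. -/
def norm (ρ : ℝ) (k : ℕ) (μ χ : ℝ) (G : ℝ → ℝ) : ℝ≥0∞ :=
  seminorm ρ 0 (-ρ) χ G + ∑ l ∈ Finset.Icc 1 k, seminorm ρ l μ χ G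

/-- The space of all `G ∈ C^k((0,∞)) ∩ C([0,∞))` with `‖G‖_{k,μ,χ} < ∞` (for `k = 1, 2`). -/
def space (ρ : ℝ) (k : ℕ) (μ χ : ℝ) : Set (ℝ → ℝ) :=
  {G | ContDiffOn ℝ k G (Ioi 0) ∧ ContinuousOn G (Ici 0) ∧ norm ρ k μ χ G < ∞}

end

end Smoluchowski

namespace Smoluchowski

noncomputable section

/-! ### Elementary integrals -/

/-! The proof replaces a profile `f` by the function `Q(q) = ∫ (1 - e^{-qx}) dν`, where `ν` has
density `f` on `(0,∞)`. It is finite before `f` is known to be integrable, and the Laplace transform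
of `f` is `m - Q`, with `m` the total mass, as soon as `m` is finite.

Integrating the profile equation against `q e^{-qx}` (`profile_equation_laplace`) gives `-q Q'' =
(1-ρ) Q' + 2 Q Q' + ε I`, where `I ≥ 0` is the contribution of `W` (`interaction`). The left-over
term is an exact derivative: the flux `F = Q(ρ - Q) - q Q'` satisfies `F' = ε I`. An Abelian
argument turns the normalisation into `Q ~ ρ q^ρ` at `0`, so `F` vanishes at `0` and `F ≥ 0`. Thus
`Q` is a subsolution of the logistic equation `q Q' = Q(ρ - Q)`, and for the constant kernel a
solution, namely `R = ρ q^ρ / (1 + q^ρ)`. Hence `Q ≤ R < ρ`, and letting `q → ∞` bounds the mass of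
`ν` by `ρ`, which is integrability of `f`.

On a bounded interval `(0, q₀]` closeness follows from the smallness of the defect: moment estimates
give `I ≤ C q^(ρ+κ-1)` with `κ > μ` (`exists_interaction_le`), and integrating from `0` bounds `R -
Q` and its two derivatives by `ε` times `q^(ρ+κ)`, `q^(ρ+κ-1)`, `q^(ρ+κ-2)`
(`LogisticSubsolution.exists_comparison`). The sign `R - Q ≥ 0` makes the nonlinear term harmless.

For large `q` the bound on `I` is not used, only its sign. Since `F` increases to a limit at most
`m(ρ - m)`, one gets `q Q' ≥ (m - Q)(m + Q - ρ)`, so `q^θ (m - Q)` is nonincreasing beyond `q₀` once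
`Q(q₀)` is close enough to `ρ` (`LogisticSubsolution.rpow_mul_tail_le`). Therefore `q₀` is chosen
first, from the explicit `R`, so that the tail of `R` is small, and `ε₀` afterwards, so that `Q(q₀)`
is close to `R(q₀)`. Both Laplace transforms then have small weighted tails separately, and complete
monotonicity carries this over to derivatives (`expMoment_le`). The two masses lie between `Q(q₀)`
and `ρ`, which controls their difference. -/

lemma lintegral_Ioc_of_hasDerivAt {Φ φ : ℝ → ℝ} {a b : ℝ} (hab : a ≤ b)
    (hΦ : ∀ x, HasDerivAt Φ (φ x) x) (hc : Continuous φ) (h0 : ∀ x, 0 ≤ φ x) :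
    ∫⁻ x in Ioc a b, ENNReal.ofReal (φ x) = ENNReal.ofReal (Φ b - Φ a) := by
  rw [← ofReal_integral_eq_lintegral_ofReal, ← intervalIntegral.integral_of_le hab,
    intervalIntegral.integral_eq_sub_of_hasDerivAt (fun x _ => hΦ x) (hc.intervalIntegrable _ _)]
  · exact (hc.integrableOn_Icc).mono_set Ioc_subset_Icc_self
  · exact Eventually.of_forall h0

lemma hasDerivAt_neg_exp_neg_mul (q x : ℝ) :
    HasDerivAt (fun x => -Real.exp (-(q * x))) (q * Real.exp (-(q * x))) x := by
  have h : HasDerivAt (fun x : ℝ => -(q * x)) (-q) x := by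
    simpa using ((hasDerivAt_id' x).const_mul q).fun_neg
  exact h.exp.fun_neg.congr_deriv (by ring)

lemma lintegral_Ioo_exp {q a b : ℝ} (hq : 0 < q) (hab : a ≤ b) :
    ∫⁻ x in Ioo a b, ENNReal.ofReal (q * Real.exp (-(q * x))) =
      ENNReal.ofReal (Real.exp (-(q * a)) - Real.exp (-(q * b))) := by
  rw [restrict_Ioo_eq_restrict_Ioc, lintegral_Ioc_of_hasDerivAt hab
    (hasDerivAt_neg_exp_neg_mul q) (by fun_prop) (fun x => by positivity)]
  congr 1
  ring

lemma lintegral_Ioi_exp {q a : ℝ} (hq : 0 < q) :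
    ∫⁻ x in Ioi a, ENNReal.ofReal (q * Real.exp (-(q * x))) =
      ENNReal.ofReal (Real.exp (-(q * a))) := by
  have h := integral_exp_mul_Ioi (a := -q) (by linarith) a
  have hi := integrableOn_exp_mul_Ioi (a := -q) (by linarith) a
  simp only [neg_mul] at h hi
  rw [← ofReal_integral_eq_lintegral_ofReal (hi.const_mul q)
    (Eventually.of_forall fun x => by positivity), integral_const_mul, h]
  congr 1
  field_simp

/-! ### Integrating the profile equation against exponentials -/

/-- Tonelli: a particle of size `y` is counted for all `x > y`, and `∫_y^∞ q e^{-qx} dx = e^{-qy}`.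
-/
lemma lintegral_exp_mul_mass {ν : Measure ℝ} [SFinite ν] (hν : ∀ᵐ x ∂ν, 0 < x) {q : ℝ}
    (hq : 0 < q) :
    ∫⁻ x in Ioi 0, ENNReal.ofReal (q * Real.exp (-(q * x))) *
        ∫⁻ y in Ioo 0 x, ENNReal.ofReal y ∂ν =
      ∫⁻ y, ENNReal.ofReal (y * Real.exp (-(q * y))) ∂ν := by
  let S : Set (ℝ × ℝ) := {p | 0 < p.2 ∧ p.2 < p.1}
  have hS : MeasurableSet S :=
    (measurableSet_lt measurable_const measurable_snd).inter
      (measurableSet_lt measurable_snd measurable_fst)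
  let G : ℝ × ℝ → ℝ≥0∞ := S.indicator fun p =>
    ENNReal.ofReal (q * Real.exp (-(q * p.1))) * ENNReal.ofReal p.2
  have hG : Measurable G := by
    refine Measurable.indicator ?_ hS
    fun_prop
  have h1 : ∀ x : ℝ, ENNReal.ofReal (q * Real.exp (-(q * x))) *
      ∫⁻ y in Ioo 0 x, ENNReal.ofReal y ∂ν = ∫⁻ y, G (x, y) ∂ν := by
    intro x
    rw [← lintegral_const_mul _ (by fun_prop), ← lintegral_indicator measurableSet_Ioo]
    rfl
  simp_rw [h1]
  rw [lintegral_lintegral_swap (f := fun x y => G (x, y)) hG.aemeasurable]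
  refine lintegral_congr_ae ?_
  filter_upwards [hν] with y hy
  have h2 : ∀ x : ℝ, G (x, y) = (Ioi y).indicator
      (fun x => ENNReal.ofReal (q * Real.exp (-(q * x))) * ENNReal.ofReal y) x := by
    intro x
    simp [G, S, indicator, hy]
  simp_rw [h2]
  rw [lintegral_indicator measurableSet_Ioi, Measure.restrict_restrict measurableSet_Ioi,
    inter_eq_left.2 (Ioi_subset_Ioi hy.le), lintegral_mul_const _ (by fun_prop),
    lintegral_Ioi_exp hq, mul_comm, ENNReal.ofReal_mul hy.le]

/-- Tonelli: a pair `(y, z)` contributes exactly for `y < x < y + z`, which yields `e^{-qy} -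
e^{-q(y+z)}`. This factorises, so a constant kernel produces a product of one-variable integrals. -/
lemma lintegral_exp_mul_flux {ν : Measure ℝ} [SFinite ν] (hν : ∀ᵐ x ∂ν, 0 < x)
    {k : ℝ × ℝ → ℝ≥0∞} (hk : Measurable k) {q : ℝ} (hq : 0 < q) :
    ∫⁻ x in Ioi 0, ENNReal.ofReal (q * Real.exp (-(q * x))) *
        ∫⁻ y in Ioo 0 x, ∫⁻ z in Ioi (x - y), k (y, z) ∂ν ∂ν =
      ∫⁻ y, ∫⁻ z, ENNReal.ofReal (Real.exp (-(q * y)) * (1 - Real.exp (-(q * z)))) *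
        k (y, z) ∂ν ∂ν := by
  let S : Set (ℝ × ℝ × ℝ) := {p | (0 < p.2.1 ∧ p.2.1 < p.1) ∧ p.1 - p.2.1 < p.2.2}
  have hS : MeasurableSet S := by
    have h1 : Measurable fun p : ℝ × ℝ × ℝ => p.2.1 := by fun_prop
    have h2 : Measurable fun p : ℝ × ℝ × ℝ => p.2.2 := by fun_prop
    exact ((measurableSet_lt measurable_const h1).inter (measurableSet_lt h1 measurable_fst)).inter
      (measurableSet_lt (measurable_fst.sub h1) h2)
  let G : ℝ × ℝ × ℝ → ℝ≥0∞ := S.indicator fun p =>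
    ENNReal.ofReal (q * Real.exp (-(q * p.1))) * k p.2
  have hG : Measurable G := by
    refine Measurable.indicator ?_ hS
    exact Measurable.mul (by fun_prop) (hk.comp measurable_snd)
  have h1 : ∀ x : ℝ, ENNReal.ofReal (q * Real.exp (-(q * x))) *
      ∫⁻ y in Ioo 0 x, ∫⁻ z in Ioi (x - y), k (y, z) ∂ν ∂ν =
        ∫⁻ p, G (x, p) ∂(ν.prod ν) := by
    intro x
    have hGx : Measurable fun p => G (x, p) := hG.comp (by fun_prop)
    rw [lintegral_prod _ hGx.aemeasurable, ← lintegral_indicator measurableSet_Ioo,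
      ← lintegral_const_mul']
    · refine lintegral_congr fun y => ?_
      by_cases hy : y ∈ Ioo 0 x
      · rw [indicator_of_mem hy, ← lintegral_const_mul' _ _ ENNReal.ofReal_ne_top,
          ← lintegral_indicator measurableSet_Ioi]
        refine lintegral_congr fun z => ?_
        have : 0 < y ∧ y < x := hy
        simp [G, S, indicator, this]
      · rw [indicator_of_notMem hy, mul_zero]
        have : ¬ (0 < y ∧ y < x) := hy
        simp [G, S, this]
    · exact ENNReal.ofReal_ne_top
  simp_rw [h1]
  rw [lintegral_lintegral_swap (f := fun x p => G (x, p)) hG.aemeasurable, lintegral_prod]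
  · refine lintegral_congr_ae ?_
    filter_upwards [hν] with y hy
    refine lintegral_congr_ae ?_
    filter_upwards [hν] with z hz
    have h2 : ∀ x : ℝ, G (x, y, z) = (Ioo y (y + z)).indicator
        (fun x => ENNReal.ofReal (q * Real.exp (-(q * x))) * k (y, z)) x := by
      intro x
      simp [G, S, indicator, hy, sub_lt_iff_lt_add']
    simp_rw [h2]
    have hsub : Ioo y (y + z) ⊆ Ioi 0 := fun x hx => hy.trans hx.1
    rw [lintegral_indicator measurableSet_Ioo, Measure.restrict_restrict measurableSet_Ioo,
      inter_eq_left.2 hsub, lintegral_mul_const _ (by fun_prop),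
      lintegral_Ioo_exp hq (by linarith)]
    congr 2
    rw [mul_add, neg_add, Real.exp_add]
    ring
  · have : Measurable fun p : (ℝ × ℝ) × ℝ => G (p.2, p.1) := hG.comp (by fun_prop)
    exact (this.lintegral_prod_right' (ν := volume.restrict (Ioi 0))).aemeasurable

/-- The measure with density `f` on `(0,∞)`. -/
def particleMeasure (f : ℝ → ℝ) : Measure ℝ :=
  (volume.restrict (Ioi 0)).withDensity fun x => ENNReal.ofReal (f x)

instance (f : ℝ → ℝ) : SFinite (particleMeasure f) := by
  unfold particleMeasure
  infer_instance

lemma ae_pos_particleMeasure (f : ℝ → ℝ) : ∀ᵐ x ∂particleMeasure f, 0 < x :=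
  (withDensity_absolutelyContinuous _ _).ae_le (ae_restrict_mem measurableSet_Ioi)

lemma lintegral_particleMeasure {f : ℝ → ℝ} (hf : LocallyIntegrableOn f (Ioi 0)) (g : ℝ → ℝ≥0∞) :
    ∫⁻ x, g x ∂particleMeasure f = ∫⁻ x in Ioi 0, ENNReal.ofReal (f x) * g x := by
  rw [particleMeasure, lintegral_withDensity_eq_lintegral_mul_non_measurable₀]
  · rfl
  · exact hf.aestronglyMeasurable.aemeasurable.ennreal_ofReal
  · exact Eventually.of_forall fun _ => ENNReal.ofReal_lt_top

lemma setLIntegral_particleMeasure {f : ℝ → ℝ} (hf : LocallyIntegrableOn f (Ioi 0))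
    (g : ℝ → ℝ≥0∞) {s : Set ℝ} (hs : MeasurableSet s) (h : s ⊆ Ioi 0) :
    ∫⁻ x in s, g x ∂particleMeasure f = ∫⁻ x in s, ENNReal.ofReal (f x) * g x := by
  rw [particleMeasure, setLIntegral_withDensity_eq_setLIntegral_mul_non_measurable₀ _ _ _ hs,
    Measure.restrict_restrict hs, inter_eq_left.2 h]
  · rfl
  · exact Eventually.of_forall fun _ => ENNReal.ofReal_lt_top
  · rw [Measure.restrict_restrict hs, inter_eq_left.2 h]
    exact (hf.aestronglyMeasurable.aemeasurable.ennreal_ofReal).mono_measure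
      (Measure.restrict_mono h le_rfl)

/-- The profile equation, integrated against `q e^{-qx}`. -/
lemma profile_equation_laplace {ρ α : ℝ} {K : ℝ → ℝ → ℝ} {f : ℝ → ℝ}
    (hf : IsSelfSimilarProfile ρ α K f) (hK : ContinuousOn (Function.uncurry K) (Ioi 0 ×ˢ Ioi 0))
    (hK0 : ∀ x y, 0 < x → 0 < y → 0 ≤ K x y)
    {q : ℝ} (hq : 0 < q) :
    ENNReal.ofReal q * ∫⁻ x, ENNReal.ofReal (x ^ 2 * Real.exp (-(q * x))) ∂particleMeasure f =
      ENNReal.ofReal (1 - ρ) * ∫⁻ x, ENNReal.ofReal (x * Real.exp (-(q * x))) ∂particleMeasure f +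
      ∫⁻ y, ∫⁻ z, ENNReal.ofReal (K y z) * ENNReal.ofReal (y * Real.exp (-(q * y))) *
        ENNReal.ofReal (1 - Real.exp (-(q * z))) ∂particleMeasure f ∂particleMeasure f := by
  set ν := particleMeasure f with hνdef
  have hν := ae_pos_particleMeasure f
  -- `K` is controlled only on the open quadrant; cutting it off there makes the integrand
  -- measurable.
  let k : ℝ × ℝ → ℝ≥0∞ := (Ioi 0 ×ˢ Ioi 0).indicator fun p => ENNReal.ofReal (p.1 * K p.1 p.2)
  have hS : MeasurableSet (Ioi (0 : ℝ) ×ˢ Ioi (0 : ℝ)) := measurableSet_Ioi.prod measurableSet_Ioi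
  have hk : Measurable k := by
    have h : Measurable ((Ioi 0 ×ˢ Ioi 0).indicator fun p : ℝ × ℝ => p.1 * K p.1 p.2) := by
      classical
      have hc : ContinuousOn (fun p : ℝ × ℝ => p.1 * K p.1 p.2) (Ioi 0 ×ˢ Ioi 0) :=
        continuousOn_fst.mul hK
      rw [← piecewise_eq_indicator]
      exact hc.measurable_piecewise continuousOn_const hS
    convert h.ennreal_ofReal using 1
    ext p
    by_cases hp : p ∈ Ioi (0 : ℝ) ×ˢ Ioi (0 : ℝ)
    · simp only [k, indicator_of_mem hp]
    · simp only [k, indicator_of_notMem hp, ENNReal.ofReal_zero]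
  have hkey : ∀ᵐ x ∂(volume.restrict (Ioi (0 : ℝ))),
      ENNReal.ofReal (x ^ 2 * f x) = ENNReal.ofReal (1 - ρ) * (∫⁻ y in Ioo 0 x, ENNReal.ofReal y ∂ν)
        + ∫⁻ y in Ioo 0 x, ∫⁻ z in Ioi (x - y), k (y, z) ∂ν ∂ν := by
    filter_upwards [hf.equation, ae_restrict_mem measurableSet_Ioi] with x hx hx0
    rw [hx]
    have hsub : Ioo 0 x ⊆ Ioi 0 := fun y hy => hy.1
    have hnn : ∀ᵐ y ∂(volume.restrict (Ioo 0 x)), 0 ≤ f y :=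
      ae_mono (Measure.restrict_mono hsub le_rfl) hf.nonneg
    congr 1
    · rw [hνdef, setLIntegral_particleMeasure hf.locallyIntegrableOn _ measurableSet_Ioo hsub]
      congr 1
      refine lintegral_congr_ae ?_
      filter_upwards [hnn] with y hy
      rw [mul_comm, ENNReal.ofReal_mul hy]
    · rw [hνdef, setLIntegral_particleMeasure hf.locallyIntegrableOn _ measurableSet_Ioo hsub]
      refine lintegral_congr_ae ?_
      filter_upwards [hnn, ae_restrict_mem measurableSet_Ioo] with y hy hyx
      have hsub' : Ioi (x - y) ⊆ Ioi 0 := Ioi_subset_Ioi (by linarith [hyx.2])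
      rw [setLIntegral_particleMeasure hf.locallyIntegrableOn _ measurableSet_Ioi hsub',
        ← lintegral_const_mul' _ _ ENNReal.ofReal_ne_top]
      refine lintegral_congr_ae ?_
      filter_upwards [ae_mono (Measure.restrict_mono hsub' le_rfl) hf.nonneg,
        ae_restrict_mem measurableSet_Ioi] with z hz hzx
      have hp : (y, z) ∈ Ioi (0 : ℝ) ×ˢ Ioi (0 : ℝ) := ⟨hyx.1, hsub' hzx⟩
      simp only [k, indicator_of_mem hp]
      rw [ENNReal.ofReal_mul' hz, ENNReal.ofReal_mul' hy]
      ring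
  have hL2 : ENNReal.ofReal q * ∫⁻ x, ENNReal.ofReal (x ^ 2 * Real.exp (-(q * x))) ∂ν =
      ∫⁻ x in Ioi 0, ENNReal.ofReal (q * Real.exp (-(q * x))) * ENNReal.ofReal (x ^ 2 * f x) := by
    rw [hνdef, lintegral_particleMeasure hf.locallyIntegrableOn,
      ← lintegral_const_mul' _ _ ENNReal.ofReal_ne_top]
    refine lintegral_congr_ae ?_
    filter_upwards [hf.nonneg] with x hx
    rw [← ENNReal.ofReal_mul hx, ← ENNReal.ofReal_mul hq.le, ← ENNReal.ofReal_mul (by positivity)]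
    congr 1
    ring
  have hsplit : ∫⁻ x in Ioi 0,
      ENNReal.ofReal (q * Real.exp (-(q * x))) * ENNReal.ofReal (x ^ 2 * f x) =
      ENNReal.ofReal (1 - ρ) * (∫⁻ x in Ioi 0, ENNReal.ofReal (q * Real.exp (-(q * x))) *
        ∫⁻ y in Ioo 0 x, ENNReal.ofReal y ∂ν) +
      ∫⁻ x in Ioi 0, ENNReal.ofReal (q * Real.exp (-(q * x))) *
        ∫⁻ y in Ioo 0 x, ∫⁻ z in Ioi (x - y), k (y, z) ∂ν ∂ν := by
    rw [← lintegral_const_mul' _ _ ENNReal.ofReal_ne_top, ← lintegral_add_left']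
    · refine lintegral_congr_ae ?_
      filter_upwards [hkey] with x hx
      rw [hx]
      ring
    · refine AEMeasurable.const_mul (AEMeasurable.mul (by fun_prop) ?_) _
      refine Measurable.aemeasurable (Monotone.measurable fun a b hab => ?_)
      exact lintegral_mono_set (Ioo_subset_Ioo le_rfl hab)
  rw [hL2, hsplit, lintegral_exp_mul_mass hν hq, lintegral_exp_mul_flux hν hk hq]
  congr 1
  refine lintegral_congr_ae ?_
  filter_upwards [hν] with y hy
  refine lintegral_congr_ae ?_
  filter_upwards [hν] with z hz
  have hp : (y, z) ∈ Ioi (0 : ℝ) ×ˢ Ioi (0 : ℝ) := ⟨hy, hz⟩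
  simp only [k, indicator_of_mem hp]
  have hz1 : 0 ≤ 1 - Real.exp (-(q * z)) := by
    simp only [sub_nonneg, Real.exp_le_one_iff, neg_nonpos]
    positivity
  rw [← ENNReal.ofReal_mul (by positivity), ← ENNReal.ofReal_mul (hK0 y z hy hz),
    ← ENNReal.ofReal_mul (mul_nonneg (hK0 y z hy hz) (by positivity))]
  congr 1
  ring

/-! ### The first moment -/

lemma integrableOn_exp_mul_rpow {ρ q : ℝ} (hρ : ρ < 2) (hq : 0 < q) :
    IntegrableOn (fun x : ℝ => q * Real.exp (-(q * x)) * x ^ (1 - ρ)) (Ioi 0) := by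
  have h := integrableOn_rpow_mul_exp_neg_mul_rpow (s := 1 - ρ) (p := 1) (b := q) (by linarith)
    one_pos hq
  refine IntegrableOn.congr_fun (h.const_mul q) (fun x _ => ?_) measurableSet_Ioi
  simp only [Real.rpow_one, neg_mul]
  ring

lemma integral_exp_mul_rpow {ρ q : ℝ} (hρ : ρ < 2) (hq : 0 < q) :
    ∫ x in Ioi (0 : ℝ), q * Real.exp (-(q * x)) * x ^ (1 - ρ) =
      Real.Gamma (2 - ρ) * q ^ (ρ - 1) := by
  have h := Real.integral_rpow_mul_exp_neg_mul_Ioi (a := 2 - ρ) (r := q) (by linarith) hq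
  have h1 : ∀ x : ℝ, q * Real.exp (-(q * x)) * x ^ (1 - ρ) =
      q * (x ^ (2 - ρ - 1) * Real.exp (-(q * x))) := by
    intro x
    rw [show 2 - ρ - 1 = 1 - ρ by ring]
    ring
  simp_rw [h1]
  rw [integral_const_mul, h, one_div, Real.inv_rpow hq.le, ← Real.rpow_neg hq.le,
    show ρ - 1 = 1 + -(2 - ρ) by ring, Real.rpow_add hq, Real.rpow_one]
  ring

lemma lintegral_mass_particleMeasure {ρ α : ℝ} {K : ℝ → ℝ → ℝ} {f : ℝ → ℝ}
    (hf : IsSelfSimilarProfile ρ α K f) (x : ℝ) :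
    ∫⁻ y in Ioo 0 x, ENNReal.ofReal y ∂particleMeasure f =
      ENNReal.ofReal (∫ y in Ioo 0 x, y * f y) := by
  have hsub : Ioo 0 x ⊆ Ioi 0 := fun y hy => hy.1
  have hnn : ∀ᵐ y ∂(volume.restrict (Ioo 0 x)), 0 ≤ f y :=
    ae_mono (Measure.restrict_mono hsub le_rfl) hf.nonneg
  rw [setLIntegral_particleMeasure hf.locallyIntegrableOn _ measurableSet_Ioo hsub,
    ofReal_integral_eq_lintegral_ofReal]
  · refine lintegral_congr_ae ?_
    filter_upwards [hnn] with y hy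
    rw [mul_comm y, ENNReal.ofReal_mul hy]
  · exact (hf.locallyIntegrableOn_mul.integrableOn_compact_subset Icc_subset_Ici_self
      isCompact_Icc).mono_set Ioo_subset_Icc_self
  · filter_upwards [hnn, ae_restrict_mem measurableSet_Ioo] with y hy h
    exact mul_nonneg h.1.le hy

lemma lintegral_first_eq {ρ α : ℝ} {K : ℝ → ℝ → ℝ} {f : ℝ → ℝ}
    (hf : IsSelfSimilarProfile ρ α K f) {q : ℝ} (hq : 0 < q) :
    ∫⁻ x, ENNReal.ofReal (x * Real.exp (-(q * x))) ∂particleMeasure f =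
      ∫⁻ x in Ioi 0, ENNReal.ofReal (q * Real.exp (-(q * x)) * ∫ y in Ioo 0 x, y * f y) := by
  rw [← lintegral_exp_mul_mass (ae_pos_particleMeasure f) hq]
  refine lintegral_congr fun x => ?_
  rw [lintegral_mass_particleMeasure hf,
    ENNReal.ofReal_mul (p := q * Real.exp (-(q * x))) (by positivity)]

lemma Gamma_two_sub_pos {ρ : ℝ} (hρ : ρ < 1) : 0 < Real.Gamma (2 - ρ) :=
  Real.Gamma_pos_of_pos (by linarith)

/-- The Gamma factor in the normalisation cancels the one from integrating `x^(1-ρ)` against `q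
e^{-qx}`. -/
lemma lintegral_first_le {ρ α : ℝ} {K : ℝ → ℝ → ℝ} {f : ℝ → ℝ} (hρ : ρ < 1)
    (hf : IsSelfSimilarProfile ρ α K f) (hn : IsNormalised ρ f) {q : ℝ} (hq : 0 < q) :
    ∫⁻ x, ENNReal.ofReal (x * Real.exp (-(q * x))) ∂particleMeasure f ≤
      ENNReal.ofReal (ρ ^ 2 * q ^ (ρ - 1)) := by
  have hΓ := Gamma_two_sub_pos hρ
  set c := ρ ^ 2 / Real.Gamma (2 - ρ) with hc
  have hi := (integrableOn_exp_mul_rpow (ρ := ρ) (by linarith) hq).const_mul c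
  have hI : ∫ x in Ioi (0 : ℝ), c * (q * Real.exp (-(q * x)) * x ^ (1 - ρ)) =
      ρ ^ 2 * q ^ (ρ - 1) := by
    rw [integral_const_mul, integral_exp_mul_rpow (by linarith) hq, hc]
    field_simp
  rw [lintegral_first_eq hf hq, ← hI, ofReal_integral_eq_lintegral_ofReal hi]
  · refine setLIntegral_mono_ae' measurableSet_Ioi (Eventually.of_forall fun x hx => ?_)
    refine ENNReal.ofReal_le_ofReal ?_
    have := hn.le x hx
    calc _ ≤ q * Real.exp (-(q * x)) * (c * x ^ (1 - ρ)) := by gcongr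
      _ = _ := by ring
  · filter_upwards [ae_restrict_mem measurableSet_Ioi] with x hx
    have : (0 : ℝ) < x := hx
    positivity

lemma ofReal_integral_le_lintegral_ofReal {μ : Measure ℝ} {g : ℝ → ℝ} (hg : Integrable g μ) :
    ENNReal.ofReal (∫ x, g x ∂μ) ≤ ∫⁻ x, ENNReal.ofReal (g x) ∂μ := by
  have h : ∀ x, ENNReal.ofReal (g x) = ENNReal.ofReal (max (g x) 0) := fun x => by simp
  simp_rw [h]
  rw [← ofReal_integral_eq_lintegral_ofReal hg.pos_part
    (Eventually.of_forall fun x => le_max_right _ _)]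
  exact ENNReal.ofReal_le_ofReal (integral_mono hg hg.pos_part fun x => le_max_left _ _)

/-- The Abelian lower bound. The mass is at least `η c x^(1-ρ)` only beyond some `R`; the loss below
`R` costs a constant, which is negligible against `q^(ρ-1)` as `q → 0`. -/
lemma le_lintegral_first {ρ α : ℝ} {K : ℝ → ℝ → ℝ} {f : ℝ → ℝ} (hρ0 : 0 < ρ) (hρ : ρ < 1)
    (hf : IsSelfSimilarProfile ρ α K f) (hn : IsNormalised ρ f) {η : ℝ} (hη0 : 0 ≤ η)
    (hη : η < 1) :
    ∃ C : ℝ, ∀ q : ℝ, 0 < q → ENNReal.ofReal (η * (ρ ^ 2 * q ^ (ρ - 1) - C)) ≤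
      ∫⁻ x, ENNReal.ofReal (x * Real.exp (-(q * x))) ∂particleMeasure f := by
  have hΓ := Gamma_two_sub_pos hρ
  set c := ρ ^ 2 / Real.Gamma (2 - ρ) with hc
  have hcpos : 0 < c := by positivity
  obtain ⟨R, hR0, hR⟩ : ∃ R : ℝ, 0 < R ∧ ∀ x, R ≤ x →
      η * (c * x ^ (1 - ρ)) ≤ ∫ y in Ioo 0 x, y * f y := by
    have h := hn.isEquivalent.isLittleO.bound (c := 1 - η) (by linarith)
    obtain ⟨R, hR⟩ := (eventually_atTop.1 h)
    refine ⟨max R 1, by positivity, fun x hx => ?_⟩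
    have hx0 : 0 < x := lt_of_lt_of_le one_pos ((le_max_right R 1).trans hx)
    have h1 := hR x ((le_max_left _ _).trans hx)
    simp only [Pi.sub_apply, Real.norm_eq_abs] at h1
    rw [abs_of_pos (a := ρ ^ 2 / Real.Gamma (2 - ρ) * x ^ (1 - ρ)) (by positivity)] at h1
    have h2 := (abs_le.1 h1).1
    rw [← hc] at h2
    linarith
  refine ⟨c * R ^ (1 - ρ), fun q hq => ?_⟩
  have hi1 := integrableOn_exp_mul_rpow (ρ := ρ) (by linarith) hq
  have hi2 : IntegrableOn (fun x : ℝ => q * Real.exp (-(q * x))) (Ioi 0) := by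
    have hi := integrableOn_exp_mul_Ioi (a := -q) (by linarith) 0
    simp only [neg_mul] at hi
    exact hi.const_mul q
  have hI2 : ∫ x in Ioi (0 : ℝ), q * Real.exp (-(q * x)) = 1 := by
    have h := integral_exp_mul_Ioi (a := -q) (by linarith) 0
    simp only [neg_mul] at h
    rw [integral_const_mul, h]
    simp [hq.ne']
  have hi : IntegrableOn (fun x : ℝ => η * c * (q * Real.exp (-(q * x)) * x ^ (1 - ρ)) -
      η * c * R ^ (1 - ρ) * (q * Real.exp (-(q * x)))) (Ioi 0) :=
    (hi1.const_mul _).sub (hi2.const_mul _)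
  have hI : η * (ρ ^ 2 * q ^ (ρ - 1) - c * R ^ (1 - ρ)) =
      ∫ x in Ioi (0 : ℝ), (η * c * (q * Real.exp (-(q * x)) * x ^ (1 - ρ)) -
      η * c * R ^ (1 - ρ) * (q * Real.exp (-(q * x)))) := by
    rw [integral_sub (hi1.const_mul _) (hi2.const_mul _), integral_const_mul, integral_const_mul,
      hI2, integral_exp_mul_rpow (by linarith) hq, hc]
    field_simp
  rw [hI, lintegral_first_eq hf hq]
  refine (ofReal_integral_le_lintegral_ofReal hi).trans ?_
  refine setLIntegral_mono_ae' measurableSet_Ioi (Eventually.of_forall fun x hx => ?_)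
  refine ENNReal.ofReal_le_ofReal ?_
  have hx0 : (0 : ℝ) < x := hx
  -- Subtracting `R^(1-ρ)` makes the lower bound nonpositive for `x ≤ R`, so it holds for all `x`
  -- without splitting the integral.
  have hM : η * c * (x ^ (1 - ρ) - R ^ (1 - ρ)) ≤ ∫ y in Ioo 0 x, y * f y := by
    rcases le_total R x with h | h
    · have h1 := hR x h
      have h2 : 0 ≤ η * c * R ^ (1 - ρ) := by positivity
      linarith
    · have h1 : x ^ (1 - ρ) ≤ R ^ (1 - ρ) := Real.rpow_le_rpow hx0.le h (by linarith)
      have h2 : 0 ≤ ∫ y in Ioo 0 x, y * f y := by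
        refine integral_nonneg_of_ae ?_
        have hnn : ∀ᵐ y ∂(volume.restrict (Ioo 0 x)), 0 ≤ f y :=
          ae_mono (Measure.restrict_mono (fun y hy => hy.1) le_rfl) hf.nonneg
        filter_upwards [hnn, ae_restrict_mem measurableSet_Ioo] with y hy h
        exact mul_nonneg h.1.le hy
      exact (mul_nonpos_of_nonneg_of_nonpos (by positivity) (by linarith)).trans h2
  calc _ = q * Real.exp (-(q * x)) * (η * c * (x ^ (1 - ρ) - R ^ (1 - ρ))) := by ring
    _ ≤ _ := by gcongr

/-! ### Exponential moments -/

/-- `∫ x^n e^{-qx} dν`. -/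
def expMoment (ν : Measure ℝ) (n : ℕ) (q : ℝ) : ℝ := ∫ x, x ^ n * Real.exp (-(q * x)) ∂ν

/-- The Bernstein function `∫ (1 - e^{-qx}) dν`. -/
def bernstein (ν : Measure ℝ) (q : ℝ) : ℝ := ∫ x, (1 - Real.exp (-(q * x))) ∂ν

lemma mul_exp_neg_le_one (t : ℝ) : t * Real.exp (-t) ≤ 1 := by
  have h := Real.add_one_le_exp t
  rw [Real.exp_neg, ← div_eq_mul_inv, div_le_one (Real.exp_pos t)]
  linarith

lemma hasDerivAt_exp_neg_mul_left (q x : ℝ) :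
    HasDerivAt (fun q => Real.exp (-(q * x))) (-(x * Real.exp (-(q * x)))) q := by
  have h : HasDerivAt (fun q : ℝ => -(q * x)) (-x) q := by
    simpa using ((hasDerivAt_id' q).mul_const x).fun_neg
  exact h.exp.congr_deriv (by ring)

/-- Half of the exponential absorbs one power of `x`. Uniformity in `s ≥ q/2` provides the
dominating function for differentiating under the integral. -/
lemma pow_succ_mul_exp_le {n : ℕ} {q x s : ℝ} (hq : 0 < q) (hx : 0 < x) (hs : q / 2 ≤ s) :
    x ^ (n + 1) * Real.exp (-(s * x)) ≤ 4 / q * (x ^ n * Real.exp (-(q / 4 * x))) := by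
  have h1 : Real.exp (-(s * x)) ≤ Real.exp (-(q / 4 * x)) * Real.exp (-(q / 4 * x)) := by
    rw [← Real.exp_add]
    refine Real.exp_le_exp.2 ?_
    nlinarith
  have h2 := mul_exp_neg_le_one (q / 4 * x)
  have h3 : x * Real.exp (-(q / 4 * x)) ≤ 4 / q := by
    rw [le_div_iff₀ hq]
    linarith
  calc x ^ (n + 1) * Real.exp (-(s * x))
      ≤ x ^ (n + 1) * (Real.exp (-(q / 4 * x)) * Real.exp (-(q / 4 * x))) := by gcongr
    _ = (x * Real.exp (-(q / 4 * x))) * (x ^ n * Real.exp (-(q / 4 * x))) := by ring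
    _ ≤ _ := by gcongr

lemma integrable_pow_succ_mul_exp {ν : Measure ℝ} (hν : ∀ᵐ x ∂ν, 0 < x) {n : ℕ}
    (h : ∀ q : ℝ, 0 < q → Integrable (fun x => x ^ n * Real.exp (-(q * x))) ν) {q : ℝ}
    (hq : 0 < q) : Integrable (fun x => x ^ (n + 1) * Real.exp (-(q * x))) ν := by
  refine ((h (q / 4) (by positivity)).const_mul (4 / q)).mono'
    (by fun_prop) ?_
  filter_upwards [hν] with x hx
  rw [Real.norm_of_nonneg (by positivity)]
  exact pow_succ_mul_exp_le hq hx (by linarith)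

lemma hasDerivAt_expMoment {ν : Measure ℝ} (hν : ∀ᵐ x ∂ν, 0 < x) {n : ℕ}
    (h : ∀ q : ℝ, 0 < q → Integrable (fun x => x ^ n * Real.exp (-(q * x))) ν) {q : ℝ}
    (hq : 0 < q) : HasDerivAt (expMoment ν n) (-expMoment ν (n + 1) q) q := by
  have hmain := (hasDerivAt_integral_of_dominated_loc_of_deriv_le (μ := ν) (𝕜 := ℝ)
    (F := fun q x => x ^ n * Real.exp (-(q * x))) (x₀ := q) (s := Ioi (q / 2))
    (bound := fun x => 4 / q * (x ^ n * Real.exp (-(q / 4 * x))))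
    (Ioi_mem_nhds (by linarith)) (Eventually.of_forall fun s => by fun_prop) (h q hq)
    (F' := fun q x => -(x ^ (n + 1) * Real.exp (-(q * x)))) (by fun_prop) ?_
    ((h (q / 4) (by positivity)).const_mul (4 / q)) ?_).2
  · rw [integral_neg] at hmain
    exact hmain
  · filter_upwards [hν] with x hx s hs
    rw [norm_neg, Real.norm_of_nonneg (by positivity)]
    exact pow_succ_mul_exp_le hq hx (mem_Ioi.1 hs).le
  · refine Eventually.of_forall fun x s _ => ?_
    exact ((hasDerivAt_exp_neg_mul_left s x).const_mul (x ^ n)).congr_deriv (by ring)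

lemma hasDerivAt_bernstein {ν : Measure ℝ} (hν : ∀ᵐ x ∂ν, 0 < x)
    (h : ∀ q : ℝ, 0 < q → Integrable (fun x => x ^ 1 * Real.exp (-(q * x))) ν)
    (h0 : ∀ q : ℝ, 0 < q → Integrable (fun x => 1 - Real.exp (-(q * x))) ν) {q : ℝ}
    (hq : 0 < q) : HasDerivAt (bernstein ν) (expMoment ν 1 q) q := by
  refine (hasDerivAt_integral_of_dominated_loc_of_deriv_le (μ := ν) (𝕜 := ℝ)
    (F := fun q x => 1 - Real.exp (-(q * x))) (x₀ := q) (s := Ioi (q / 2))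
    (bound := fun x => x ^ 1 * Real.exp (-(q / 2 * x)))
    (Ioi_mem_nhds (by linarith)) (Eventually.of_forall fun s => by fun_prop) (h0 q hq)
    (F' := fun q x => x ^ 1 * Real.exp (-(q * x))) (by fun_prop) ?_
    (h (q / 2) (by positivity)) ?_).2
  · filter_upwards [hν] with x hx s hs
    rw [Real.norm_of_nonneg (by positivity)]
    have := (mem_Ioi.1 hs).le
    gcongr
  · refine Eventually.of_forall fun x s _ => ?_
    exact ((hasDerivAt_exp_neg_mul_left s x).const_sub 1).congr_deriv (by ring)

lemma one_sub_exp_neg_nonneg {t : ℝ} (ht : 0 ≤ t) : 0 ≤ 1 - Real.exp (-t) := by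
  simpa using ht

lemma lintegral_rpow_Ioc {a q : ℝ} (ha : -1 < a) (hq : 0 ≤ q) :
    ∫⁻ s in Ioc 0 q, ENNReal.ofReal (s ^ a) = ENNReal.ofReal (q ^ (a + 1) / (a + 1)) := by
  have hi := intervalIntegral.intervalIntegrable_rpow' (a := 0) (b := q) ha
  rw [← ofReal_integral_eq_lintegral_ofReal hi.1, ← intervalIntegral.integral_of_le hq,
    integral_rpow (Or.inl ha), Real.zero_rpow (by linarith), sub_zero]
  filter_upwards [ae_restrict_mem measurableSet_Ioc] with s hs
  exact Real.rpow_nonneg hs.1.le _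

/-- Write `1 - e^{-qx} = ∫_0^q x e^{-sx} ds`, exchange the integrals, and use `∫_0^q ρ² s^(ρ-1) ds =
ρ q^ρ`. Finiteness of the measure is not needed. -/
lemma lintegral_bernstein_le {ν : Measure ℝ} [SFinite ν] (hν : ∀ᵐ x ∂ν, 0 < x) {ρ : ℝ}
    (hρ : 0 < ρ) (h : ∀ q : ℝ, 0 < q → ∫⁻ x, ENNReal.ofReal (x * Real.exp (-(q * x))) ∂ν ≤
      ENNReal.ofReal (ρ ^ 2 * q ^ (ρ - 1))) {q : ℝ} (hq : 0 < q) :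
    ∫⁻ x, ENNReal.ofReal (1 - Real.exp (-(q * x))) ∂ν ≤ ENNReal.ofReal (ρ * q ^ ρ) := by
  have h1 : ∫⁻ x, ENNReal.ofReal (1 - Real.exp (-(q * x))) ∂ν =
      ∫⁻ x, (∫⁻ s in Ioc 0 q, ENNReal.ofReal (x * Real.exp (-(s * x)))) ∂ν := by
    refine lintegral_congr_ae ?_
    filter_upwards [hν] with x hx
    rw [lintegral_Ioc_of_hasDerivAt (Φ := fun s => -Real.exp (-(s * x))) hq.le
      (fun s => (hasDerivAt_exp_neg_mul_left s x).fun_neg.congr_deriv (by ring)) (by fun_prop)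
      (fun s => by positivity)]
    congr 1
    simp
    ring
  rw [h1, lintegral_lintegral_swap (by fun_prop)]
  calc _ ≤ ∫⁻ s in Ioc 0 q, ENNReal.ofReal (ρ ^ 2) * ENNReal.ofReal (s ^ (ρ - 1)) := by
        refine setLIntegral_mono_ae' measurableSet_Ioc (Eventually.of_forall fun s hs => ?_)
        rw [← ENNReal.ofReal_mul (by positivity)]
        exact h s hs.1
    _ = _ := by
        rw [lintegral_const_mul' _ _ ENNReal.ofReal_ne_top, lintegral_rpow_Ioc (by linarith) hq.le,
          ← ENNReal.ofReal_mul (by positivity)]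
        congr 1
        rw [sub_add_cancel]
        field_simp

lemma integrable_of_lintegral_ofReal_le {ν : Measure ℝ} {g : ℝ → ℝ} {C : ℝ}
    (hg : AEStronglyMeasurable g ν) (h0 : 0 ≤ᵐ[ν] g)
    (h : ∫⁻ x, ENNReal.ofReal (g x) ∂ν ≤ ENNReal.ofReal C) : Integrable g ν :=
  ⟨hg, (hasFiniteIntegral_iff_ofReal h0).2 (h.trans_lt ENNReal.ofReal_lt_top)⟩

/-! ### Subsolutions of the logistic equation -/

/-- All differential inequalities below are integrated from `q = 0`, where only one-sided limits are
available. -/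
lemma le_of_deriv_nonneg_of_tendsto {g g' : ℝ → ℝ} {r l : ℝ}
    (hg : ∀ q, 0 < q → q ≤ r → HasDerivAt g (g' q) q) (h0 : ∀ q, 0 < q → q ≤ r → 0 ≤ g' q)
    (hl : Tendsto g (nhdsWithin 0 (Ioi 0)) (nhds l)) {q : ℝ} (hq : 0 < q) (hqr : q ≤ r) :
    l ≤ g q := by
  have hmono : MonotoneOn g (Ioc 0 r) := by
    refine monotoneOn_of_hasDerivWithinAt_nonneg (f' := g') (convex_Ioc 0 r)
      (fun x hx => (hg x hx.1 hx.2).continuousAt.continuousWithinAt) (fun x hx => ?_)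
      (fun x hx => ?_)
    · rw [interior_Ioc] at hx
      exact (hg x hx.1 hx.2.le).hasDerivWithinAt
    · rw [interior_Ioc] at hx
      exact h0 x hx.1 hx.2.le
  refine le_of_tendsto hl ?_
  filter_upwards [Ioc_mem_nhdsGT hq] with s hs
  exact hmono ⟨hs.1, hs.2.trans hqr⟩ ⟨hq, hqr⟩ hs.2

lemma tendsto_mul_rpow_nhdsGT_zero (c : ℝ) {a : ℝ} (ha : 0 < a) :
    Tendsto (fun q : ℝ => c * q ^ a) (nhdsWithin 0 (Ioi 0)) (nhds 0) := by
  have h : Tendsto (fun q : ℝ => c * q ^ a) (nhds 0) (nhds (c * (0 : ℝ) ^ a)) :=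
    (Real.continuousAt_rpow_const 0 a (Or.inr ha.le)).tendsto.const_mul c
  rw [Real.zero_rpow ha.ne', mul_zero] at h
  exact h.mono_left nhdsWithin_le_nhds

/-- A function `Q` with derivatives `Q₁` and `-Q₂`, that behaves like `ρ q^ρ` as `q → 0`, and for
which `Q (ρ - Q) - q Q₁` is increasing. -/
structure LogisticSubsolution (ρ : ℝ) (Q Q₁ Q₂ : ℝ → ℝ) : Prop where
  hasDerivAt : ∀ q, 0 < q → HasDerivAt Q (Q₁ q) q
  hasDerivAt₁ : ∀ q, 0 < q → HasDerivAt Q₁ (-Q₂ q) q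
  nonneg : ∀ q, 0 < q → 0 ≤ Q q
  pos₁ : ∀ q, 0 < q → 0 < Q₁ q
  le_rpow : ∀ q, 0 < q → Q q ≤ ρ * q ^ ρ
  le_rpow₁ : ∀ q, 0 < q → Q₁ q ≤ ρ ^ 2 * q ^ (ρ - 1)
  rpow_le₁ : ∀ η, 0 ≤ η → η < 1 →
    ∀ᶠ q in nhdsWithin (0 : ℝ) (Ioi 0), η * (ρ ^ 2 * q ^ (ρ - 1)) ≤ Q₁ q
  defect_nonneg : ∀ q, 0 < q → 0 ≤ q * Q₂ q - (1 - ρ) * Q₁ q - 2 * Q q * Q₁ q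

namespace LogisticSubsolution

variable {ρ : ℝ} {Q Q₁ Q₂ : ℝ → ℝ}

/-- The second-order equation integrates once: its defect is the derivative of the logistic defect
`Q(ρ - Q) - q Q'`. -/
lemma hasDerivAt_flux (h : LogisticSubsolution ρ Q Q₁ Q₂) {q : ℝ} (hq : 0 < q) :
    HasDerivAt (fun q => Q q * (ρ - Q q) - q * Q₁ q)
      (q * Q₂ q - (1 - ρ) * Q₁ q - 2 * Q q * Q₁ q) q := by
  have h1 := h.hasDerivAt q hq
  have h2 := h.hasDerivAt₁ q hq
  exact ((h1.fun_mul (h1.const_sub ρ)).fun_sub ((hasDerivAt_id' q).fun_mul h2)).congr_deriv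
    (by ring)

lemma tendsto_zero (h : LogisticSubsolution ρ Q Q₁ Q₂) (hρ : 0 < ρ) :
    Tendsto Q (nhdsWithin 0 (Ioi 0)) (nhds 0) := by
  refine tendsto_of_tendsto_of_tendsto_of_le_of_le' tendsto_const_nhds
    (tendsto_mul_rpow_nhdsGT_zero ρ hρ) ?_ ?_
  · filter_upwards [self_mem_nhdsWithin] with q hq using h.nonneg q hq
  · filter_upwards [self_mem_nhdsWithin] with q hq using h.le_rpow q hq

lemma tendsto_mul_zero (h : LogisticSubsolution ρ Q Q₁ Q₂) (hρ : 0 < ρ) :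
    Tendsto (fun q => q * Q₁ q) (nhdsWithin 0 (Ioi 0)) (nhds 0) := by
  refine tendsto_of_tendsto_of_tendsto_of_le_of_le' tendsto_const_nhds
    (tendsto_mul_rpow_nhdsGT_zero (ρ ^ 2) hρ) ?_ ?_
  · filter_upwards [self_mem_nhdsWithin] with q hq
    exact mul_nonneg (le_of_lt hq) (h.pos₁ q hq).le
  · filter_upwards [self_mem_nhdsWithin] with q hq
    have hq' : 0 < q := hq
    calc q * Q₁ q ≤ q * (ρ ^ 2 * q ^ (ρ - 1)) :=
          mul_le_mul_of_nonneg_left (h.le_rpow₁ q hq) hq'.le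
      _ = ρ ^ 2 * q ^ ρ := by
          rw [Real.rpow_sub_one hq'.ne']
          field_simp

lemma tendsto_flux_zero (h : LogisticSubsolution ρ Q Q₁ Q₂) (hρ : 0 < ρ) :
    Tendsto (fun q => Q q * (ρ - Q q) - q * Q₁ q) (nhdsWithin 0 (Ioi 0)) (nhds 0) := by
  have h1 := h.tendsto_zero hρ
  simpa using (h1.mul (h1.const_sub ρ)).sub (h.tendsto_mul_zero hρ)

lemma flux_nonneg (h : LogisticSubsolution ρ Q Q₁ Q₂) (hρ : 0 < ρ) {q : ℝ} (hq : 0 < q) :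
    0 ≤ Q q * (ρ - Q q) - q * Q₁ q :=
  le_of_deriv_nonneg_of_tendsto (fun _ hs _ => h.hasDerivAt_flux hs)
    (fun s hs _ => h.defect_nonneg s hs) (h.tendsto_flux_zero hρ) hq le_rfl

lemma monotoneOn_flux (h : LogisticSubsolution ρ Q Q₁ Q₂) :
    MonotoneOn (fun q => Q q * (ρ - Q q) - q * Q₁ q) (Ioi 0) := by
  refine monotoneOn_of_hasDerivWithinAt_nonneg
    (f' := fun q => q * Q₂ q - (1 - ρ) * Q₁ q - 2 * Q q * Q₁ q) (convex_Ioi 0)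
    (fun x hx => (h.hasDerivAt_flux hx).continuousAt.continuousWithinAt) (fun x hx => ?_)
    (fun x hx => ?_)
  · rw [interior_Ioi] at hx
    exact (h.hasDerivAt_flux hx).hasDerivWithinAt
  · rw [interior_Ioi] at hx
    exact h.defect_nonneg x hx

/-- The logistic inequality gives `Q(ρ - Q) ≥ q Q' > 0`. This is the source of the mass bound. -/
lemma lt_rho (h : LogisticSubsolution ρ Q Q₁ Q₂) (hρ : 0 < ρ) {q : ℝ} (hq : 0 < q) :
    Q q < ρ := by
  have h1 := h.flux_nonneg hρ hq
  have h2 := mul_pos hq (h.pos₁ q hq)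
  have h3 : 0 < Q q * (ρ - Q q) := by linarith
  linarith [pos_of_mul_pos_right h3 (h.nonneg q hq)]

lemma monotoneOn (h : LogisticSubsolution ρ Q Q₁ Q₂) : MonotoneOn Q (Ioi 0) := by
  refine monotoneOn_of_hasDerivWithinAt_nonneg (f' := Q₁) (convex_Ioi 0)
    (fun x hx => (h.hasDerivAt x hx).continuousAt.continuousWithinAt) (fun x hx => ?_)
    (fun x hx => ?_)
  · rw [interior_Ioi] at hx
    exact (h.hasDerivAt x hx).hasDerivWithinAt
  · rw [interior_Ioi] at hx
    exact (h.pos₁ x hx).le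

/-- The lower bound on `Q₁` is integrated from `0`. The limit fixes the scaling parameter in the
one-parameter family of solutions of the logistic equation. -/
lemma tendsto_mul_rpow_neg (h : LogisticSubsolution ρ Q Q₁ Q₂) (hρ : 0 < ρ) :
    Tendsto (fun q => Q q * q ^ (-ρ)) (nhdsWithin 0 (Ioi 0)) (nhds ρ) := by
  have hupper : ∀ q, 0 < q → Q q * q ^ (-ρ) ≤ ρ := by
    intro q hq
    have hp : 0 < q ^ ρ := Real.rpow_pos_of_pos hq ρ
    rw [Real.rpow_neg hq.le, ← div_eq_mul_inv, div_le_iff₀ hp]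
    exact h.le_rpow q hq
  refine tendsto_order.2 ⟨fun a ha => ?_, fun a ha => ?_⟩
  · obtain ⟨η, hη0, hη1, hη⟩ : ∃ η : ℝ, 0 ≤ η ∧ η < 1 ∧ a < η * ρ := by
      -- Halfway between `a / ρ` and `1`, truncated at `0` because `a` may be negative.
      refine ⟨max 0 ((a / ρ + 1) / 2), le_max_left _ _, max_lt one_pos ?_, ?_⟩
      · have : a / ρ < 1 := (div_lt_one hρ).2 ha
        linarith
      · have h1 : (a / ρ + 1) / 2 * ρ = (a + ρ) / 2 := by field_simp
        have h2 := mul_le_mul_of_nonneg_right (le_max_right 0 ((a / ρ + 1) / 2)) hρ.le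
        linarith
    have hev := h.rpow_le₁ η hη0 hη1
    obtain ⟨r, hr0, hr⟩ := (mem_nhdsGT_iff_exists_Ioc_subset).1 hev
    filter_upwards [Ioc_mem_nhdsGT hr0] with q hq
    have hlow : 0 ≤ Q q - η * ρ * q ^ ρ := by
      refine le_of_deriv_nonneg_of_tendsto (g := fun q => Q q - η * ρ * q ^ ρ)
        (g' := fun q => Q₁ q - η * ρ * (ρ * q ^ (ρ - 1))) (r := r) (fun s hs _ => ?_)
        (fun s hs hsr => ?_) ?_ hq.1 hq.2
      · exact (h.hasDerivAt s hs).fun_sub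
          ((Real.hasDerivAt_rpow_const (Or.inl hs.ne')).const_mul (η * ρ))
      · have : η * (ρ ^ 2 * s ^ (ρ - 1)) ≤ Q₁ s := hr ⟨hs, hsr⟩
        nlinarith
      · simpa using (h.tendsto_zero hρ).sub (tendsto_mul_rpow_nhdsGT_zero (η * ρ) hρ)
    have hp : 0 < q ^ ρ := Real.rpow_pos_of_pos hq.1 ρ
    rw [Real.rpow_neg hq.1.le, ← div_eq_mul_inv, lt_div_iff₀ hp]
    have := mul_lt_mul_of_pos_right hη hp
    linarith
  · filter_upwards [self_mem_nhdsWithin] with q hq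
    exact (hupper q hq).trans_lt ha

/-- `Q q^(-ρ) / (ρ - Q)` is the first integral of the logistic equation; along a subsolution its
derivative is a negative multiple of the flux. -/
lemma hasDerivAt_ratio (h : LogisticSubsolution ρ Q Q₁ Q₂) (hρ : 0 < ρ) {q : ℝ} (hq : 0 < q) :
    HasDerivAt (fun q => Q q * q ^ (-ρ) / (ρ - Q q))
      (-(ρ * q ^ (-ρ - 1) * (Q q * (ρ - Q q) - q * Q₁ q) / (ρ - Q q) ^ 2)) q := by
  have h1 := h.hasDerivAt q hq
  have h2 : HasDerivAt (fun q : ℝ => q ^ (-ρ)) (-ρ * q ^ (-ρ - 1)) q :=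
    Real.hasDerivAt_rpow_const (Or.inl hq.ne')
  have h3 : ρ - Q q ≠ 0 := (sub_pos.2 (h.lt_rho hρ hq)).ne'
  refine ((h1.fun_mul h2).fun_div (h1.const_sub ρ) h3).congr_deriv ?_
  have h4 : q ^ (-ρ) = q * q ^ (-ρ - 1) := by
    rw [Real.rpow_sub_one hq.ne']
    field_simp
  rw [h4]
  field_simp
  ring

lemma tendsto_ratio (h : LogisticSubsolution ρ Q Q₁ Q₂) (hρ : 0 < ρ) :
    Tendsto (fun q => Q q * q ^ (-ρ) / (ρ - Q q)) (nhdsWithin 0 (Ioi 0)) (nhds 1) := by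
  have h1 := (h.tendsto_mul_rpow_neg hρ).div ((h.tendsto_zero hρ).const_sub ρ)
    (by simpa using hρ.ne')
  rw [sub_zero, div_self hρ.ne'] at h1
  exact h1

lemma ratio_le_iff (h : LogisticSubsolution ρ Q Q₁ Q₂) (hρ : 0 < ρ) {q : ℝ} (hq : 0 < q) :
    Q q * q ^ (-ρ) / (ρ - Q q) ≤ 1 ↔ Q q ≤ ρ * q ^ ρ / (1 + q ^ ρ) := by
  have hp : 0 < q ^ ρ := Real.rpow_pos_of_pos hq ρ
  rw [Real.rpow_neg hq.le, div_le_one (sub_pos.2 (h.lt_rho hρ hq)), ← div_eq_mul_inv,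
    div_le_iff₀ hp, le_div_iff₀ (by positivity)]
  constructor <;> intro _ <;> nlinarith

/-- The first integral tends to `1` at `0` and does not increase. -/
lemma le_logistic (h : LogisticSubsolution ρ Q Q₁ Q₂) (hρ : 0 < ρ) {q : ℝ} (hq : 0 < q) :
    Q q ≤ ρ * q ^ ρ / (1 + q ^ ρ) := by
  rw [← h.ratio_le_iff hρ hq]
  have := le_of_deriv_nonneg_of_tendsto (fun s hs _ => (h.hasDerivAt_ratio hρ hs).fun_neg)
    (fun s hs _ => ?_) (h.tendsto_ratio hρ).neg hq le_rfl
  · linarith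
  · rw [neg_neg]
    have := h.flux_nonneg hρ hs
    positivity

/-- With zero defect the flux vanishes identically, so the first integral is constant and equal to
its limit `1`. -/
lemma eq_logistic (h : LogisticSubsolution ρ Q Q₁ Q₂) (hρ : 0 < ρ)
    (h0 : ∀ q, 0 < q → q * Q₂ q - (1 - ρ) * Q₁ q - 2 * Q q * Q₁ q = 0) {q : ℝ} (hq : 0 < q) :
    Q q = ρ * q ^ ρ / (1 + q ^ ρ) ∧ q * Q₁ q = Q q * (ρ - Q q) := by
  have hflux : ∀ q, 0 < q → Q q * (ρ - Q q) - q * Q₁ q = 0 := by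
    intro q hq
    refine le_antisymm ?_ (h.flux_nonneg hρ hq)
    have := le_of_deriv_nonneg_of_tendsto (fun s hs _ => (h.hasDerivAt_flux hs).fun_neg)
      (fun s hs _ => by rw [h0 s hs, neg_zero]) (h.tendsto_flux_zero hρ).neg hq le_rfl
    linarith
  refine ⟨le_antisymm (h.le_logistic hρ hq) ?_, by linarith [hflux q hq]⟩
  have h1 := le_of_deriv_nonneg_of_tendsto (fun s hs _ => h.hasDerivAt_ratio hρ hs)
    (fun s hs _ => by rw [hflux s hs]; simp) (h.tendsto_ratio hρ) hq le_rfl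
  have hp : 0 < q ^ ρ := Real.rpow_pos_of_pos hq ρ
  rw [Real.rpow_neg hq.le, one_le_div (sub_pos.2 (h.lt_rho hρ hq)), ← div_eq_mul_inv,
    le_div_iff₀ hp] at h1
  rw [div_le_iff₀ (by positivity)]
  nlinarith

/-! ### Behaviour at infinity -/

lemma le_mass (h : LogisticSubsolution ρ Q Q₁ Q₂) {m : ℝ} (hm : Tendsto Q atTop (nhds m)) {q : ℝ}
    (hq : 0 < q) : Q q ≤ m := by
  refine ge_of_tendsto hm ?_
  filter_upwards [eventually_ge_atTop q] with s hs
  exact h.monotoneOn hq (hq.trans_le hs) hs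

/-- The flux is nondecreasing, and dropping `s Q₁(s) > 0` bounds it by a quantity tending to `m(ρ -
m)`. The claim follows from `Q(ρ - Q) - m(ρ - m) = (m - Q)(m + Q - ρ)`. -/
lemma mul_deriv_ge (h : LogisticSubsolution ρ Q Q₁ Q₂) {m : ℝ}
    (hm : Tendsto Q atTop (nhds m)) {q : ℝ} (hq : 0 < q) :
    (m - Q q) * (m + Q q - ρ) ≤ q * Q₁ q := by
  have h1 : Q q * (ρ - Q q) - q * Q₁ q ≤ m * (ρ - m) := by
    refine ge_of_tendsto (hm.mul (hm.const_sub ρ)) ?_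
    filter_upwards [eventually_ge_atTop q] with s hs
    have hs0 := hq.trans_le hs
    have h2 : Q q * (ρ - Q q) - q * Q₁ q ≤ Q s * (ρ - Q s) - s * Q₁ s :=
      h.monotoneOn_flux hq hs0 hs
    have := mul_pos hs0 (h.pos₁ s hs0)
    linarith
  nlinarith

/-- Since `m + Q - ρ ≥ θ` persists beyond `q₀` by monotonicity of `Q`, the tail satisfies `q (m -
Q)' ≤ -θ (m - Q)`. -/
lemma rpow_mul_tail_le (h : LogisticSubsolution ρ Q Q₁ Q₂) {m θ q₀ : ℝ}
    (hm : Tendsto Q atTop (nhds m)) (hq₀ : 0 < q₀) (hθ : θ ≤ m + Q q₀ - ρ) {q : ℝ} (hq : q₀ ≤ q) :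
    q ^ θ * (m - Q q) ≤ q₀ ^ θ * (m - Q q₀) := by
  have hanti : AntitoneOn (fun q => q ^ θ * (m - Q q)) (Ici q₀) := by
    have hd : ∀ s, 0 < s → HasDerivAt (fun q => q ^ θ * (m - Q q))
        (s ^ (θ - 1) * (θ * (m - Q s) - s * Q₁ s)) s := by
      intro s hs
      have h1 : HasDerivAt (fun q : ℝ => q ^ θ) (θ * s ^ (θ - 1)) s :=
        Real.hasDerivAt_rpow_const (Or.inl hs.ne')
      refine (h1.fun_mul ((h.hasDerivAt s hs).const_sub m)).congr_deriv ?_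
      have h4 : s ^ θ = s * s ^ (θ - 1) := by
        rw [Real.rpow_sub_one hs.ne']
        field_simp
      rw [h4]
      ring
    refine antitoneOn_of_hasDerivWithinAt_nonpos
      (f' := fun s => s ^ (θ - 1) * (θ * (m - Q s) - s * Q₁ s)) (convex_Ici q₀)
      (fun x hx => (hd x (hq₀.trans_le hx)).continuousAt.continuousWithinAt) (fun x hx => ?_)
      (fun x hx => ?_)
    · rw [interior_Ici] at hx
      exact (hd x (hq₀.trans hx)).hasDerivWithinAt
    · rw [interior_Ici] at hx
      have hx0 : 0 < x := hq₀.trans hx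
      refine mul_nonpos_of_nonneg_of_nonpos (Real.rpow_nonneg hx0.le _) ?_
      have h1 := h.mul_deriv_ge hm hx0
      have h2 := h.le_mass hm hx0
      have h3 : Q q₀ ≤ Q x := h.monotoneOn hq₀ hx0 (le_of_lt hx)
      nlinarith
  exact hanti (mem_Ici.2 le_rfl) (mem_Ici.2 hq) hq

end LogisticSubsolution

/-! ### Comparison with the solution of the logistic equation -/

namespace LogisticSubsolution

variable {ρ : ℝ} {Q Q₁ Q₂ R R₁ R₂ : ℝ → ℝ}

lemma flux_le (h : LogisticSubsolution ρ Q Q₁ Q₂) (hρ : 0 < ρ) {κ q₀ A : ℝ} (hκ : 0 < κ)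
    (hA : ∀ q, 0 < q → q ≤ q₀ →
      q * Q₂ q - (1 - ρ) * Q₁ q - 2 * Q q * Q₁ q ≤ A * q ^ (ρ + κ - 1))
    {q : ℝ} (hq : 0 < q) (hqq : q ≤ q₀) :
    Q q * (ρ - Q q) - q * Q₁ q ≤ A / (ρ + κ) * q ^ (ρ + κ) := by
  have h1 := le_of_deriv_nonneg_of_tendsto (r := q₀)
    (fun s hs _ => (((Real.hasDerivAt_rpow_const (p := ρ + κ) (Or.inl hs.ne')).const_mul
      (A / (ρ + κ))).fun_sub (h.hasDerivAt_flux hs)))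
    (fun s hs hsq => ?_)
    ((tendsto_mul_rpow_nhdsGT_zero (A / (ρ + κ)) (a := ρ + κ) (by linarith)).sub
      (h.tendsto_flux_zero hρ)) hq hqq
  · linarith
  · have h2 : A / (ρ + κ) * ((ρ + κ) * s ^ (ρ + κ - 1)) = A * s ^ (ρ + κ - 1) := by
      field_simp
    linarith [hA s hs hsq]

/-- With `H = R - Q ≥ 0` and `F` the flux of `Q`, one has `s H' = (ρ - R - Q) H + F`, hence `(s^(-ρ)
H)' = s^(-ρ-1) (F - (R + Q) H) ≤ s^(-ρ-1) F`. The common asymptotics at `0` make `s^(-ρ) H` start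
from `0`. -/
lemma sub_le (hQ : LogisticSubsolution ρ Q Q₁ Q₂) (hR : LogisticSubsolution ρ R R₁ R₂)
    (hρ : 0 < ρ) (hR0 : ∀ q, 0 < q → q * R₂ q - (1 - ρ) * R₁ q - 2 * R q * R₁ q = 0)
    {κ q₀ a : ℝ} (hκ : 0 < κ)
    (ha : ∀ q, 0 < q → q ≤ q₀ → Q q * (ρ - Q q) - q * Q₁ q ≤ a * q ^ (ρ + κ))
    {q : ℝ} (hq : 0 < q) (hqq : q ≤ q₀) : R q - Q q ≤ a / κ * q ^ (ρ + κ) := by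
  have hlim : Tendsto (fun s => a / κ * s ^ κ - (R s * s ^ (-ρ) - Q s * s ^ (-ρ)))
      (nhdsWithin 0 (Ioi 0)) (nhds (0 - (ρ - ρ))) :=
    (tendsto_mul_rpow_nhdsGT_zero (a / κ) hκ).sub
      ((hR.tendsto_mul_rpow_neg hρ).sub (hQ.tendsto_mul_rpow_neg hρ))
  have hpow : ∀ s : ℝ, 0 < s → HasDerivAt (fun q : ℝ => q ^ (-ρ)) (-ρ * s ^ (-ρ - 1)) s :=
    fun s hs => Real.hasDerivAt_rpow_const (Or.inl hs.ne')
  have h1 := le_of_deriv_nonneg_of_tendsto (r := q₀)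
    (fun s hs _ => ((Real.hasDerivAt_rpow_const (p := κ) (Or.inl hs.ne')).const_mul (a / κ)).fun_sub
      (((hR.hasDerivAt s hs).fun_mul (hpow s hs)).fun_sub
        ((hQ.hasDerivAt s hs).fun_mul (hpow s hs)))) (fun s hs hsq => ?_) hlim hq hqq
  · have hp : 0 < q ^ (-ρ) := Real.rpow_pos_of_pos hq _
    have h2 : q ^ κ = q ^ (ρ + κ) * q ^ (-ρ) := by
      rw [← Real.rpow_add hq]
      congr 1
      ring
    rw [h2] at h1
    have h3 : (R q - Q q) * q ^ (-ρ) ≤ a / κ * q ^ (ρ + κ) * q ^ (-ρ) := by linarith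
    exact le_of_mul_le_mul_right h3 hp
  · have h2 : s ^ (-ρ) = s * s ^ (-ρ - 1) := by
      rw [Real.rpow_sub_one hs.ne']
      field_simp
    have h3 : a / κ * (κ * s ^ (κ - 1)) = a * s ^ (ρ + κ) * s ^ (-ρ - 1) := by
      rw [mul_assoc a, ← Real.rpow_add hs, show ρ + κ + (-ρ - 1) = κ - 1 by ring]
      field_simp
    have h4 := (hR.eq_logistic hρ hR0 hs)
    have h5 : 0 ≤ R s - Q s := by
      rw [h4.1]
      linarith [hQ.le_logistic hρ hs]
    have h6 := ha s hs hsq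
    have hp : 0 < s ^ (-ρ - 1) := Real.rpow_pos_of_pos hs _
    rw [h3, h2]
    have h7 : 0 ≤ a * s ^ (ρ + κ) + (R s - Q s) * (R s + Q s) -
        (Q s * (ρ - Q s) - s * Q₁ s) := by
      have := mul_nonneg h5 (add_nonneg (hR.nonneg s hs) (hQ.nonneg s hs))
      linarith
    have h8 : a * s ^ (ρ + κ) * s ^ (-ρ - 1) -
        (R₁ s * (s * s ^ (-ρ - 1)) + R s * (-ρ * s ^ (-ρ - 1)) -
        (Q₁ s * (s * s ^ (-ρ - 1)) + Q s * (-ρ * s ^ (-ρ - 1)))) =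
        s ^ (-ρ - 1) * (a * s ^ (ρ + κ) + (R s - Q s) * (R s + Q s) -
        (Q s * (ρ - Q s) - s * Q₁ s)) := by
      linear_combination (-s ^ (-ρ - 1)) * h4.2
    rw [h8]
    positivity

/-- A subsolution with small defect is close to the solution, together with two derivatives. -/
lemma exists_comparison (hρ : 0 < ρ) (hρ1 : ρ < 1) {κ q₀ : ℝ} (hκ : 0 < κ) (hq₀ : 0 < q₀) :
    ∃ C : ℝ, 0 < C ∧ ∀ {Q Q₁ Q₂ R R₁ R₂ : ℝ → ℝ}, LogisticSubsolution ρ Q Q₁ Q₂ →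
      LogisticSubsolution ρ R R₁ R₂ →
      (∀ q, 0 < q → q * R₂ q - (1 - ρ) * R₁ q - 2 * R q * R₁ q = 0) →
      ∀ A : ℝ, (∀ q, 0 < q → q ≤ q₀ →
        q * Q₂ q - (1 - ρ) * Q₁ q - 2 * Q q * Q₁ q ≤ A * q ^ (ρ + κ - 1)) →
      ∀ q, 0 < q → q ≤ q₀ → |R q - Q q| ≤ C * A * q ^ (ρ + κ) ∧
        |R₁ q - Q₁ q| ≤ C * A * q ^ (ρ + κ - 1) ∧ |R₂ q - Q₂ q| ≤ C * A * q ^ (ρ + κ - 2) := by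
  have hs : 0 < ρ + κ := by linarith
  set c : ℝ := 1 / (ρ + κ) / κ + 1 / (ρ + κ) with hc
  have hcpos : 0 < c := by positivity
  -- The three terms come from `(1 - ρ + 2R)(R₁ - Q₁)`, from `2(R - Q) Q₁` and from the defect
  -- itself, in the identity for `q (R₂ - Q₂)`; `c` already bounds the first two differences.
  refine ⟨3 * c + 2 * c * q₀ ^ ρ + 1, by positivity, ?_⟩
  intro Q Q₁ Q₂ R R₁ R₂ hQ hR hR0 A hA q hq hqq
  have hp : 0 < q ^ (ρ + κ - 2) := Real.rpow_pos_of_pos hq _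
  have hA0 : 0 ≤ A := by
    have h1 := (hQ.defect_nonneg q hq).trans (hA q hq hqq)
    exact nonneg_of_mul_nonneg_left h1 (Real.rpow_pos_of_pos hq _)
  have e1 : q ^ (ρ + κ - 1) = q * q ^ (ρ + κ - 2) := by
    rw [show ρ + κ - 1 = 1 + (ρ + κ - 2) by ring, Real.rpow_add hq, Real.rpow_one]
  have e0 : q ^ (ρ + κ) = q * q ^ (ρ + κ - 1) := by
    rw [show ρ + κ = 1 + (ρ + κ - 1) by ring, Real.rpow_add hq, Real.rpow_one]
    ring_nf
  have hflux := fun s h h' => hQ.flux_le hρ hκ hA (q := s) h h'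
  have hH := hQ.sub_le hR hρ hR0 hκ hflux hq hqq
  have hF := hflux q hq hqq
  have hF0 := hQ.flux_nonneg hρ hq
  have h4 := hR.eq_logistic hρ hR0 hq
  have hH0 : 0 ≤ R q - Q q := by
    rw [h4.1]
    linarith [hQ.le_logistic hρ hq]
  have hq0p : 0 < q₀ ^ ρ := Real.rpow_pos_of_pos hq₀ ρ
  set X := q ^ (ρ + κ - 1) with hX
  have hXpos : 0 < X := Real.rpow_pos_of_pos hq _
  have hHc : R q - Q q ≤ c * A * (q * X) := by
    rw [← e0]
    refine hH.trans (mul_le_mul_of_nonneg_right ?_ (Real.rpow_nonneg hq.le _))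
    have h1 : A / (ρ + κ) / κ = 1 / (ρ + κ) / κ * A := by ring
    have h2 : 0 ≤ 1 / (ρ + κ) * A := by positivity
    rw [h1, hc]
    linarith
  have hH1 : |R₁ q - Q₁ q| ≤ c * A * X := by
    have h1 : q * (R₁ q - Q₁ q) = (R q - Q q) * (ρ - R q - Q q) +
        (Q q * (ρ - Q q) - q * Q₁ q) := by linear_combination h4.2
    have h2 : |ρ - R q - Q q| ≤ 1 := by
      have := hR.lt_rho hρ hq
      have := hQ.lt_rho hρ hq
      have := hR.nonneg q hq
      have := hQ.nonneg q hq
      rw [abs_le]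
      constructor <;> linarith
    have h3 : q * |R₁ q - Q₁ q| ≤ q * (c * A * X) := by
      calc q * |R₁ q - Q₁ q| = |q * (R₁ q - Q₁ q)| := by rw [abs_mul, abs_of_pos hq]
        _ ≤ |(R q - Q q) * (ρ - R q - Q q)| + |Q q * (ρ - Q q) - q * Q₁ q| := by
            rw [h1]; exact abs_add_le _ _
        _ ≤ (R q - Q q) * 1 + (Q q * (ρ - Q q) - q * Q₁ q) := by
            rw [abs_mul, abs_of_nonneg hH0, abs_of_nonneg hF0]
            gcongr
        _ ≤ A / (ρ + κ) / κ * q ^ (ρ + κ) + A / (ρ + κ) * q ^ (ρ + κ) := by linarith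
        _ = q * (c * A * X) := by rw [e0, hc]; ring
    exact le_of_mul_le_mul_left h3 hq
  refine ⟨?_, ?_, ?_⟩
  · rw [abs_of_nonneg hH0, e0]
    refine hHc.trans (mul_le_mul_of_nonneg_right (mul_le_mul_of_nonneg_right ?_ hA0)
      (by positivity))
    have : 0 < 2 * c * q₀ ^ ρ := by positivity
    linarith
  · refine hH1.trans (mul_le_mul_of_nonneg_right (mul_le_mul_of_nonneg_right ?_ hA0)
      (by positivity))
    have : 0 < 2 * c * q₀ ^ ρ := by positivity
    linarith
  · set D := q * Q₂ q - (1 - ρ) * Q₁ q - 2 * Q q * Q₁ q with hD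
    have hD0 : 0 ≤ D := hQ.defect_nonneg q hq
    have hDA : D ≤ A * X := hA q hq hqq
    have h1 : q * (R₂ q - Q₂ q) = (1 - ρ + 2 * R q) * (R₁ q - Q₁ q) +
        2 * (R q - Q q) * Q₁ q - D := by
      linear_combination (hR0 q hq)
    have hRb : 0 ≤ 1 - ρ + 2 * R q ∧ 1 - ρ + 2 * R q ≤ 3 := by
      have := hR.lt_rho hρ hq
      have := hR.nonneg q hq
      constructor <;> linarith
    have hQ1 := (hQ.pos₁ q hq).le
    have hqQ : q * Q₁ q ≤ q₀ ^ ρ := by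
      calc q * Q₁ q ≤ q * (ρ ^ 2 * q ^ (ρ - 1)) :=
            mul_le_mul_of_nonneg_left (hQ.le_rpow₁ q hq) hq.le
        _ = ρ ^ 2 * q ^ ρ := by
            rw [Real.rpow_sub_one hq.ne']
            field_simp
        _ ≤ 1 * q₀ ^ ρ := by
            gcongr
            nlinarith
        _ = q₀ ^ ρ := one_mul _
    have h3 : q * |R₂ q - Q₂ q| ≤ (3 * c + 2 * c * q₀ ^ ρ + 1) * A * X := by
      calc q * |R₂ q - Q₂ q| = |q * (R₂ q - Q₂ q)| := by rw [abs_mul, abs_of_pos hq]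
        _ ≤ |(1 - ρ + 2 * R q) * (R₁ q - Q₁ q)| + |2 * (R q - Q q) * Q₁ q| + |D| := by
            rw [h1]
            exact (abs_sub _ _).trans (add_le_add_left (abs_add_le _ _) _)
        _ = (1 - ρ + 2 * R q) * |R₁ q - Q₁ q| + 2 * (R q - Q q) * Q₁ q + D := by
            rw [abs_mul, abs_of_nonneg hRb.1,
              abs_of_nonneg (mul_nonneg (mul_nonneg two_pos.le hH0) hQ1), abs_of_nonneg hD0]
        _ ≤ 3 * (c * A * X) + 2 * (c * A * (q * X)) * Q₁ q + A * X := by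
            gcongr
            exact hRb.2
        _ = (3 * c + 2 * c * (q * Q₁ q) + 1) * A * X := by ring
        _ ≤ _ := by gcongr
    have h5 : q * |R₂ q - Q₂ q| ≤
        q * ((3 * c + 2 * c * q₀ ^ ρ + 1) * A * q ^ (ρ + κ - 2)) := by
      calc _ ≤ _ := h3
        _ = _ := by rw [e1]; ring
    exact le_of_mul_le_mul_left h5 hq

end LogisticSubsolution

/-! ### Estimates for the interaction term -/

lemma lintegral_rpow_Ioc_of_pos {a c s : ℝ} (ha : 0 < a) (hac : a ≤ c) (hs : s ≠ -1) :
    ∫⁻ r in Ioc a c, ENNReal.ofReal (r ^ s) =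
      ENNReal.ofReal ((c ^ (s + 1) - a ^ (s + 1)) / (s + 1)) := by
  have h0 : (0 : ℝ) ∉ uIcc a c := by
    rw [uIcc_of_le hac]
    exact fun h => absurd h.1 (not_le.2 ha)
  have hi : IntervalIntegrable (fun r : ℝ => r ^ s) volume a c :=
    intervalIntegral.intervalIntegrable_rpow (Or.inr h0)
  rw [← ofReal_integral_eq_lintegral_ofReal hi.1, ← intervalIntegral.integral_of_le hac,
    integral_rpow (Or.inr ⟨hs, h0⟩)]
  filter_upwards [ae_restrict_mem measurableSet_Ioc] with r hr
  exact Real.rpow_nonneg (ha.trans hr.1).le _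

lemma lintegral_rpow_Ioi {a s : ℝ} (ha : 0 < a) (hs : s < -1) :
    ∫⁻ r in Ioi a, ENNReal.ofReal (r ^ s) = ENNReal.ofReal (-a ^ (s + 1) / (s + 1)) := by
  rw [← ofReal_integral_eq_lintegral_ofReal (integrableOn_Ioi_rpow_of_lt hs ha),
    integral_Ioi_rpow_of_lt hs ha]
  filter_upwards [ae_restrict_mem measurableSet_Ioi] with r hr
  exact Real.rpow_nonneg (ha.trans hr).le _

lemma rpow_le_one_add {t a : ℝ} (ht : 0 ≤ t) (ha0 : 0 ≤ a) (ha : a ≤ 1) : t ^ a ≤ 1 + t := by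
  rcases le_total t 1 with h | h
  · exact (Real.rpow_le_one ht h ha0).trans (by linarith)
  · calc t ^ a ≤ t ^ (1 : ℝ) := Real.rpow_le_rpow_of_exponent_le h ha
      _ = t := Real.rpow_one t
      _ ≤ 1 + t := by linarith

/-- The additional power is paid for by half of the exponential: `(qx)^α ≤ 2 e^{qx/2}`. -/
lemma lintegral_rpow_one_add_le {ν : Measure ℝ} (hν : ∀ᵐ x ∂ν, 0 < x) {ρ α : ℝ} (hρ0 : 0 < ρ)
    (hρ : ρ < 1) (hα0 : 0 ≤ α) (hα : α ≤ 1)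
    (h : ∀ q : ℝ, 0 < q → ∫⁻ x, ENNReal.ofReal (x * Real.exp (-(q * x))) ∂ν ≤
      ENNReal.ofReal (ρ ^ 2 * q ^ (ρ - 1))) {q : ℝ} (hq : 0 < q) :
    ∫⁻ x, ENNReal.ofReal (x ^ (1 + α) * Real.exp (-(q * x))) ∂ν ≤
      ENNReal.ofReal (4 * q ^ (ρ - 1 - α)) := by
  have hpt : ∀ x : ℝ, 0 < x → x ^ (1 + α) * Real.exp (-(q * x)) ≤
      2 * q ^ (-α) * (x * Real.exp (-(q / 2 * x))) := by
    intro x hx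
    have h1 : (q * x) ^ α ≤ 2 * Real.exp (q / 2 * x) := by
      have h2 := rpow_le_one_add (mul_pos hq hx).le hα0 hα
      have h3 := Real.add_one_le_exp (q / 2 * x)
      linarith
    rw [Real.mul_rpow hq.le hx.le] at h1
    have hqa : 0 < q ^ α := Real.rpow_pos_of_pos hq α
    have h4 : x ^ α ≤ 2 * q ^ (-α) * Real.exp (q / 2 * x) := by
      rw [Real.rpow_neg hq.le, ← div_eq_mul_inv, div_mul_eq_mul_div, le_div_iff₀ hqa]
      linarith
    rw [Real.rpow_add hx, Real.rpow_one]
    calc x * x ^ α * Real.exp (-(q * x))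
        ≤ x * (2 * q ^ (-α) * Real.exp (q / 2 * x)) * Real.exp (-(q * x)) := by gcongr
      _ = 2 * q ^ (-α) * (x * (Real.exp (q / 2 * x) * Real.exp (-(q * x)))) := by ring
      _ = _ := by
          rw [← Real.exp_add]
          ring_nf
  have hqa : 0 < q ^ (-α) := Real.rpow_pos_of_pos hq _
  calc ∫⁻ x, ENNReal.ofReal (x ^ (1 + α) * Real.exp (-(q * x))) ∂ν
      ≤ ∫⁻ x, ENNReal.ofReal (2 * q ^ (-α)) * ENNReal.ofReal (x * Real.exp (-(q / 2 * x))) ∂ν := by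
        refine lintegral_mono_ae ?_
        filter_upwards [hν] with x hx
        rw [← ENNReal.ofReal_mul (by positivity)]
        exact ENNReal.ofReal_le_ofReal (hpt x hx)
    _ ≤ ENNReal.ofReal (2 * q ^ (-α)) * ENNReal.ofReal (ρ ^ 2 * (q / 2) ^ (ρ - 1)) := by
        rw [lintegral_const_mul' _ _ ENNReal.ofReal_ne_top]
        gcongr
        exact h (q / 2) (by positivity)
    _ ≤ _ := by
        rw [← ENNReal.ofReal_mul (by positivity)]
        refine ENNReal.ofReal_le_ofReal ?_
        have h2 : (2 : ℝ) ^ (1 - ρ) ≤ 2 := by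
          calc (2 : ℝ) ^ (1 - ρ) ≤ 2 ^ (1 : ℝ) :=
                Real.rpow_le_rpow_of_exponent_le one_le_two (by linarith)
            _ = 2 := Real.rpow_one 2
        have h3 : (q / 2) ^ (ρ - 1) = q ^ (ρ - 1) * 2 ^ (1 - ρ) := by
          rw [Real.div_rpow hq.le two_pos.le, div_eq_mul_inv, ← Real.rpow_neg two_pos.le, neg_sub]
        have h4 : q ^ (ρ - 1 - α) = q ^ (-α) * q ^ (ρ - 1) := by
          rw [← Real.rpow_add hq]
          ring_nf
        have hqr : 0 < q ^ (ρ - 1) := Real.rpow_pos_of_pos hq _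
        rw [h3, h4]
        calc 2 * q ^ (-α) * (ρ ^ 2 * (q ^ (ρ - 1) * 2 ^ (1 - ρ)))
            ≤ 2 * q ^ (-α) * (1 * (q ^ (ρ - 1) * 2)) := by
              gcongr
              nlinarith
          _ = _ := by ring

/-- For `y < 1/q` the power is dominated by a superposition of exponentials: on `q < r ≤ 1/y` one
has `e^{-ry} ≥ e^{-1}`, and `∫ r^(-b) dr` over that range recovers `y^(b-1)` up to the boundary
term. -/
lemma ofReal_rpow_sub_one_le {b q y : ℝ} (hb0 : 0 ≤ b) (hb : b ≤ 1) (hq : 0 < q) (hy : 0 < y) :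
    ENNReal.ofReal (y ^ (b - 1)) ≤ ENNReal.ofReal (q ^ (1 - b)) +
      ENNReal.ofReal (Real.exp 1) *
        ∫⁻ r in Ioi q, ENNReal.ofReal (Real.exp (-(r * y)) * r ^ (-b)) := by
  rcases le_or_gt (1 / q) y with h | h
  · refine le_add_right (ENNReal.ofReal_le_ofReal ?_)
    have h1 : y ^ (b - 1) ≤ (1 / q) ^ (b - 1) :=
      Real.rpow_le_rpow_of_nonpos (by positivity) h (by linarith)
    rwa [one_div, Real.inv_rpow hq.le, ← Real.rpow_neg hq.le, neg_sub] at h1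
  -- At `b = 1` the integral of `r^(-b)` would be a logarithm, but the left side is just `1`.
  rcases hb.eq_or_lt with rfl | hb
  · simp
  have hqy : q ≤ 1 / y := by
    rw [lt_div_iff₀ hq] at h
    rw [le_div_iff₀ hy]
    linarith
  have hle : ENNReal.ofReal (Real.exp (-1)) * ∫⁻ r in Ioc q (1 / y), ENNReal.ofReal (r ^ (-b)) ≤
      ∫⁻ r in Ioi q, ENNReal.ofReal (Real.exp (-(r * y)) * r ^ (-b)) := by
    rw [← lintegral_const_mul' _ _ ENNReal.ofReal_ne_top]
    refine le_trans ?_ (lintegral_mono_set (fun r hr => hr.1 : Ioc q (1 / y) ⊆ Ioi q))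
    refine setLIntegral_mono_ae' measurableSet_Ioc (Eventually.of_forall fun r hr => ?_)
    rw [← ENNReal.ofReal_mul (Real.exp_pos _).le]
    have hr0 : 0 < r := hq.trans hr.1
    have : r * y ≤ 1 := by
      have := hr.2
      rwa [le_div_iff₀ hy] at this
    gcongr
  rw [lintegral_rpow_Ioc_of_pos hq hqy (by linarith),
    ← ENNReal.ofReal_mul (Real.exp_pos _).le] at hle
  refine le_trans ?_ (add_le_add_right (mul_le_mul_right hle _) _)
  rw [← ENNReal.ofReal_mul (Real.exp_pos _).le]
  refine le_trans (ENNReal.ofReal_le_ofReal ?_) ENNReal.ofReal_add_le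
  have h1 : (1 / y) ^ (-b + 1) = y ^ (b - 1) := by
    rw [one_div, Real.inv_rpow hy.le, ← Real.rpow_neg hy.le]
    ring_nf
  have h2 : Real.exp 1 * Real.exp (-1) = 1 := by
    rw [← Real.exp_add]
    simp
  have h3 : q ^ (1 - b) ≤ y ^ (b - 1) := by
    rw [← h1, neg_add_eq_sub]
    exact Real.rpow_le_rpow hq.le hqy (by linarith)
  rw [h1, ← mul_assoc, h2, one_mul, neg_add_eq_sub]
  have h4 : y ^ (b - 1) - q ^ (1 - b) ≤ (y ^ (b - 1) - q ^ (1 - b)) / (1 - b) := by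
    rw [le_div_iff₀ (by linarith)]
    nlinarith
  linarith

/-- The superposition reduces this to first moments at rates `r > q`; the resulting `∫_q^∞ r^(ρ-b-1)
dr` converges because `b > ρ`. -/
lemma lintegral_rpow_mul_exp_le {ν : Measure ℝ} [SFinite ν] (hν : ∀ᵐ x ∂ν, 0 < x) {ρ b : ℝ}
    (hρ0 : 0 < ρ) (hρ : ρ < 1) (hρb : ρ < b) (hb : b ≤ 1)
    (h : ∀ q : ℝ, 0 < q → ∫⁻ x, ENNReal.ofReal (x * Real.exp (-(q * x))) ∂ν ≤
      ENNReal.ofReal (ρ ^ 2 * q ^ (ρ - 1))) {q : ℝ} (hq : 0 < q) :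
    ∫⁻ x, ENNReal.ofReal (x ^ b * Real.exp (-(q * x))) ∂ν ≤
      ENNReal.ofReal ((1 + Real.exp 1 / (b - ρ)) * q ^ (ρ - b)) := by
  have hbρ : 0 < b - ρ := by linarith
  have hρ2 : ρ ^ 2 ≤ 1 := by nlinarith
  have hqr : 0 < q ^ (ρ - 1) := Real.rpow_pos_of_pos hq _
  have hqb : 0 < q ^ (ρ - b) := Real.rpow_pos_of_pos hq _
  calc ∫⁻ x, ENNReal.ofReal (x ^ b * Real.exp (-(q * x))) ∂ν
      ≤ ∫⁻ x, (ENNReal.ofReal (q ^ (1 - b)) * ENNReal.ofReal (x * Real.exp (-(q * x))) +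
        ENNReal.ofReal (Real.exp 1) * ∫⁻ r in Ioi q,
          ENNReal.ofReal (r ^ (-b)) * ENNReal.ofReal (x * Real.exp (-(r * x)))) ∂ν := by
        refine lintegral_mono_ae ?_
        filter_upwards [hν] with x hx
        have e1 : x ^ b = x * x ^ (b - 1) := by
          rw [Real.rpow_sub_one hx.ne']
          field_simp
        have e2 : ENNReal.ofReal (x ^ b * Real.exp (-(q * x))) =
            ENNReal.ofReal (x * Real.exp (-(q * x))) * ENNReal.ofReal (x ^ (b - 1)) := by
          rw [← ENNReal.ofReal_mul (by positivity), e1]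
          ring_nf
        rw [e2]
        refine (mul_le_mul_right (ofReal_rpow_sub_one_le (by linarith) hb hq hx) _).trans ?_
        rw [mul_add, mul_comm (ENNReal.ofReal (q ^ (1 - b)))]
        refine add_le_add le_rfl ?_
        rw [mul_left_comm]
        refine mul_le_mul_right ?_ _
        rw [← lintegral_const_mul' _ _ ENNReal.ofReal_ne_top]
        refine setLIntegral_mono_ae' measurableSet_Ioi (Eventually.of_forall fun r hr => ?_)
        have hr0 : 0 < r := hq.trans hr
        rw [← ENNReal.ofReal_mul (by positivity), ← ENNReal.ofReal_mul (by positivity)]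
        refine ENNReal.ofReal_le_ofReal ?_
        have h1 : Real.exp (-(q * x)) ≤ 1 := by
          rw [Real.exp_le_one_iff]
          nlinarith [mul_pos hq hx]
        calc x * Real.exp (-(q * x)) * (Real.exp (-(r * x)) * r ^ (-b))
            ≤ x * 1 * (Real.exp (-(r * x)) * r ^ (-b)) := by gcongr
          _ = _ := by ring
    _ = ENNReal.ofReal (q ^ (1 - b)) * ∫⁻ x, ENNReal.ofReal (x * Real.exp (-(q * x))) ∂ν +
        ENNReal.ofReal (Real.exp 1) * ∫⁻ r in Ioi q, ENNReal.ofReal (r ^ (-b)) *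
          ∫⁻ x, ENNReal.ofReal (x * Real.exp (-(r * x))) ∂ν := by
        rw [lintegral_add_left (by fun_prop), lintegral_const_mul' _ _ ENNReal.ofReal_ne_top,
          lintegral_const_mul' _ _ ENNReal.ofReal_ne_top,
          lintegral_lintegral_swap (by fun_prop)]
        simp_rw [lintegral_const_mul' _ _ ENNReal.ofReal_ne_top]
    _ ≤ ENNReal.ofReal (q ^ (1 - b)) * ENNReal.ofReal (q ^ (ρ - 1)) +
        ENNReal.ofReal (Real.exp 1) * ∫⁻ r in Ioi q, ENNReal.ofReal (r ^ (ρ - b - 1)) := by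
        refine add_le_add (mul_le_mul_right ?_ _) (mul_le_mul_right ?_ _)
        · refine (h q hq).trans (ENNReal.ofReal_le_ofReal ?_)
          nlinarith
        · refine setLIntegral_mono_ae' measurableSet_Ioi (Eventually.of_forall fun r hr => ?_)
          have hr0 : 0 < r := hq.trans hr
          refine (mul_le_mul_right (h r hr0) _).trans ?_
          rw [← ENNReal.ofReal_mul (by positivity)]
          refine ENNReal.ofReal_le_ofReal ?_
          have e : r ^ (ρ - b - 1) = r ^ (-b) * r ^ (ρ - 1) := by
            rw [← Real.rpow_add hr0]
            ring_nf
          have h1 : 0 < r ^ (-b) * r ^ (ρ - 1) := by positivity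
          rw [e]
          nlinarith
    _ = _ := by
        rw [lintegral_rpow_Ioi hq (by linarith), ← ENNReal.ofReal_mul (by positivity),
          ← Real.rpow_add hq, sub_add_cancel, ← ENNReal.ofReal_mul (Real.exp_pos _).le,
          ← ENNReal.ofReal_add (by positivity)]
        · congr 1
          rw [show (1 - b + (ρ - 1)) = ρ - b by ring, ← neg_sub b ρ]
          field_simp
        · refine mul_nonneg (Real.exp_pos _).le ?_
          rw [← neg_sub b ρ, neg_div_neg_eq]
          positivity

/-- The counterpart at large sizes: for `z > 1/q` use `1 - e^{-rz} ≥ 1/2` on `1/z < r ≤ q`. -/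
lemma ofReal_rpow_le {a q z : ℝ} (ha0 : 0 ≤ a) (ha1 : a ≤ 1) (hq : 0 < q) (hz : 0 < z) :
    ENNReal.ofReal (z ^ a) ≤ ENNReal.ofReal (q ^ (-a)) +
      2 * ∫⁻ r in Ioc 0 q, ENNReal.ofReal (r ^ (-1 - a)) *
        ENNReal.ofReal (1 - Real.exp (-(r * z))) := by
  rcases le_or_gt z (1 / q) with h | h
  · refine le_add_right (ENNReal.ofReal_le_ofReal ?_)
    have h1 : z ^ a ≤ (1 / q) ^ a := Real.rpow_le_rpow hz.le h ha0
    rwa [one_div, Real.inv_rpow hq.le, ← Real.rpow_neg hq.le] at h1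
  rcases ha0.eq_or_lt with rfl | ha0
  · simp
  have hqz : 1 / z ≤ q := by
    rw [div_lt_iff₀ hq] at h
    rw [div_le_iff₀ hz]
    linarith
  have hz1 : 0 < 1 / z := by positivity
  have hle : (∫⁻ r in Ioc (1 / z) q, ENNReal.ofReal (r ^ (-1 - a))) ≤
      2 * ∫⁻ r in Ioc 0 q, ENNReal.ofReal (r ^ (-1 - a)) *
        ENNReal.ofReal (1 - Real.exp (-(r * z))) := by
    rw [← lintegral_const_mul' _ _ ENNReal.ofNat_ne_top]
    refine le_trans ?_ (lintegral_mono_set (Ioc_subset_Ioc_left hz1.le))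
    refine setLIntegral_mono_ae' measurableSet_Ioc (Eventually.of_forall fun r hr => ?_)
    have hr0 : 0 < r := hz1.trans hr.1
    have hrz : 1 ≤ r * z := by
      have := hr.1.le
      rwa [div_le_iff₀ hz] at this
    rw [← ENNReal.ofReal_mul (by positivity), ← ENNReal.ofReal_ofNat,
      ← ENNReal.ofReal_mul two_pos.le]
    refine ENNReal.ofReal_le_ofReal ?_
    have h1 : Real.exp (-(r * z)) ≤ 1 / 2 := by
      rw [Real.exp_neg, ← one_div]
      refine one_div_le_one_div_of_le two_pos ?_
      linarith [Real.add_one_le_exp (r * z)]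
    have h2 : 0 < r ^ (-1 - a) := Real.rpow_pos_of_pos hr0 _
    nlinarith
  refine le_trans ?_ (add_le_add_right hle _)
  rw [lintegral_rpow_Ioc_of_pos hz1 hqz (by linarith)]
  refine le_trans (ENNReal.ofReal_le_ofReal ?_) ENNReal.ofReal_add_le
  have h1 : (1 / z) ^ (-1 - a + 1) = z ^ a := by
    rw [one_div, Real.inv_rpow hz.le, ← Real.rpow_neg hz.le]
    ring_nf
  have h2 : q ^ (-a) ≤ z ^ a := by
    rw [← h1, show -1 - a + 1 = -a by ring]
    exact Real.rpow_le_rpow_of_nonpos hz1 hqz (by linarith)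
  rw [h1, show -1 - a + 1 = -a by ring, ← neg_sub (z ^ a), neg_div_neg_eq]
  have h4 : z ^ a - q ^ (-a) ≤ (z ^ a - q ^ (-a)) / a := by
    rw [le_div_iff₀ ha0]
    nlinarith
  linarith

/-- After superposition the remaining integral is `∫_0^q r^(ρ-a-1) dr`, convergent because `a < ρ`.
-/
lemma lintegral_rpow_mul_one_sub_exp_le {ν : Measure ℝ} [SFinite ν] (hν : ∀ᵐ x ∂ν, 0 < x)
    {ρ a : ℝ} (hρ : ρ < 1) (ha0 : 0 ≤ a) (ha : a < ρ)
    (h : ∀ q : ℝ, 0 < q → ∫⁻ x, ENNReal.ofReal (1 - Real.exp (-(q * x))) ∂ν ≤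
      ENNReal.ofReal (ρ * q ^ ρ)) {q : ℝ} (hq : 0 < q) :
    ∫⁻ x, ENNReal.ofReal (x ^ a * (1 - Real.exp (-(q * x)))) ∂ν ≤
      ENNReal.ofReal ((1 + 2 / (ρ - a)) * q ^ (ρ - a)) := by
  have haρ : 0 < ρ - a := by linarith
  have hqa : 0 < q ^ (-a) := Real.rpow_pos_of_pos hq _
  have hle : ∀ q : ℝ, 0 < q → ∫⁻ x, ENNReal.ofReal (1 - Real.exp (-(q * x))) ∂ν ≤
      ENNReal.ofReal (q ^ ρ) := by
    intro q hq
    refine (h q hq).trans (ENNReal.ofReal_le_ofReal ?_)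
    have : 0 < q ^ ρ := Real.rpow_pos_of_pos hq _
    nlinarith
  calc ∫⁻ x, ENNReal.ofReal (x ^ a * (1 - Real.exp (-(q * x)))) ∂ν
      ≤ ∫⁻ x, (ENNReal.ofReal (q ^ (-a)) * ENNReal.ofReal (1 - Real.exp (-(q * x))) +
        2 * ∫⁻ r in Ioc 0 q, ENNReal.ofReal (r ^ (-1 - a)) *
          ENNReal.ofReal (1 - Real.exp (-(r * x)))) ∂ν := by
        refine lintegral_mono_ae ?_
        filter_upwards [hν] with x hx
        have h1 : 0 ≤ 1 - Real.exp (-(q * x)) := one_sub_exp_neg_nonneg (mul_pos hq hx).le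
        have h2 : ENNReal.ofReal (1 - Real.exp (-(q * x))) ≤ 1 := by
          rw [ENNReal.ofReal_le_one]
          linarith [Real.exp_pos (-(q * x))]
        rw [ENNReal.ofReal_mul (by positivity)]
        refine (mul_le_mul_left (ofReal_rpow_le ha0 (by linarith) hq hx) _).trans ?_
        rw [add_mul]
        exact add_le_add le_rfl ((mul_le_mul_right h2 _).trans_eq (mul_one _))
    _ = ENNReal.ofReal (q ^ (-a)) * ∫⁻ x, ENNReal.ofReal (1 - Real.exp (-(q * x))) ∂ν +
        2 * ∫⁻ r in Ioc 0 q, ENNReal.ofReal (r ^ (-1 - a)) *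
          ∫⁻ x, ENNReal.ofReal (1 - Real.exp (-(r * x))) ∂ν := by
        rw [lintegral_add_left (by fun_prop), lintegral_const_mul' _ _ ENNReal.ofReal_ne_top,
          lintegral_const_mul' _ _ ENNReal.ofNat_ne_top,
          lintegral_lintegral_swap (by fun_prop)]
        simp_rw [lintegral_const_mul' _ _ ENNReal.ofReal_ne_top]
    _ ≤ ENNReal.ofReal (q ^ (-a)) * ENNReal.ofReal (q ^ ρ) +
        2 * ∫⁻ r in Ioc 0 q, ENNReal.ofReal (r ^ (ρ - a - 1)) := by
        refine add_le_add (mul_le_mul_right (hle q hq) _) (mul_le_mul_right ?_ _)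
        refine setLIntegral_mono_ae' measurableSet_Ioc (Eventually.of_forall fun r hr => ?_)
        refine (mul_le_mul_right (hle r hr.1) _).trans ?_
        have := Real.rpow_nonneg hr.1.le (-1 - a)
        rw [← ENNReal.ofReal_mul this, ← Real.rpow_add hr.1]
        ring_nf
        exact le_rfl
    _ = _ := by
        rw [lintegral_rpow_Ioc (by linarith) hq.le, ← ENNReal.ofReal_mul (by positivity),
          ← Real.rpow_add hq, sub_add_cancel, ← ENNReal.ofReal_ofNat,
          ← ENNReal.ofReal_mul two_pos.le, ← ENNReal.ofReal_add (by positivity) (by positivity)]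
        congr 1
        rw [neg_add_eq_sub]
        ring

/-- The exponent `1 - α` may lie below `ρ`, where first moments give no control; the finite mass
covers `x ≤ 1` and the larger exponent `b > ρ` covers `x ≥ 1`. -/
lemma lintegral_rpow_one_sub_le {ν : Measure ℝ} [SFinite ν] (hν : ∀ᵐ x ∂ν, 0 < x) {ρ α b : ℝ}
    (hρ0 : 0 < ρ) (hρ : ρ < 1) (hα : α ≤ 1) (hρb : ρ < b) (hb : b ≤ 1)
    (hαb : 1 - α ≤ b)
    (h : ∀ q : ℝ, 0 < q → ∫⁻ x, ENNReal.ofReal (x * Real.exp (-(q * x))) ∂ν ≤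
      ENNReal.ofReal (ρ ^ 2 * q ^ (ρ - 1))) (hmass : ν univ ≤ 1) {q : ℝ} (hq : 0 < q) :
    ∫⁻ x, ENNReal.ofReal (x ^ (1 - α) * Real.exp (-(q * x))) ∂ν ≤
      ENNReal.ofReal (1 + (1 + Real.exp 1 / (b - ρ)) * q ^ (ρ - b)) := by
  have hbρ : 0 < b - ρ := by linarith
  have hpt : ∀ᵐ x ∂ν, ENNReal.ofReal (x ^ (1 - α) * Real.exp (-(q * x))) ≤
      1 + ENNReal.ofReal (x ^ b * Real.exp (-(q * x))) := by
    filter_upwards [hν] with x hx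
    rw [← ENNReal.ofReal_one, ← ENNReal.ofReal_add one_pos.le (by positivity)]
    refine ENNReal.ofReal_le_ofReal ?_
    have h1 : Real.exp (-(q * x)) ≤ 1 := by
      rw [Real.exp_le_one_iff]
      nlinarith [mul_pos hq hx]
    have h2 : x ^ (1 - α) ≤ 1 + x ^ b := by
      rcases le_total x 1 with h3 | h3
      · linarith [Real.rpow_le_one hx.le h3 (by linarith : 0 ≤ 1 - α),
          Real.rpow_nonneg hx.le b]
      · linarith [Real.rpow_le_rpow_of_exponent_le h3 hαb]
    calc x ^ (1 - α) * Real.exp (-(q * x)) ≤ (1 + x ^ b) * Real.exp (-(q * x)) := by gcongr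
      _ ≤ _ := by linarith
  refine (lintegral_mono_ae hpt).trans ?_
  rw [lintegral_add_left (by fun_prop), lintegral_one,
    ENNReal.ofReal_add one_pos.le (by positivity), ENNReal.ofReal_one]
  exact add_le_add hmass (lintegral_rpow_mul_exp_le hν hρ0 hρ hρb hb h hq)

/-- Split at `z = 1/q`. For small `z`, `1 - e^{-qz} ≤ qz` compensates the singular power, and `1 ≤ e
· e^{-qz}` restores the exponential. -/
lemma rpow_neg_mul_one_sub_exp_le {α q z : ℝ} (hα0 : 0 ≤ α) (hq : 0 < q) (hz : 0 < z) :
    z ^ (-α) * (1 - Real.exp (-(q * z))) ≤ q ^ α * (1 - Real.exp (-(q * z))) +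
      Real.exp 1 * q * (z ^ (1 - α) * Real.exp (-(q * z))) := by
  have h1 : 0 ≤ 1 - Real.exp (-(q * z)) := one_sub_exp_neg_nonneg (mul_pos hq hz).le
  have hqa : 0 < q ^ α := Real.rpow_pos_of_pos hq _
  rcases le_total (1 / q) z with h | h
  · have h2 : z ^ (-α) ≤ (1 / q) ^ (-α) :=
      Real.rpow_le_rpow_of_nonpos (by positivity) h (by linarith)
    rw [one_div, Real.inv_rpow hq.le, ← Real.rpow_neg hq.le, neg_neg] at h2
    have h3 : 0 ≤ Real.exp 1 * q * (z ^ (1 - α) * Real.exp (-(q * z))) := by positivity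
    linarith [mul_le_mul_of_nonneg_right h2 h1]
  · have hqz : q * z ≤ 1 := by
      rw [le_div_iff₀ hq] at h
      linarith
    have h2 : 1 - Real.exp (-(q * z)) ≤ q * z := by
      linarith [Real.add_one_le_exp (-(q * z))]
    have h3 : 1 ≤ Real.exp 1 * Real.exp (-(q * z)) := by
      rw [← Real.exp_add]
      exact Real.one_le_exp (by linarith)
    have h4 : z ^ (1 - α) = z * z ^ (-α) := by
      rw [sub_eq_add_neg, Real.rpow_add hz, Real.rpow_one]
    have hza : 0 < z ^ (-α) := Real.rpow_pos_of_pos hz _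
    calc z ^ (-α) * (1 - Real.exp (-(q * z))) ≤ z ^ (-α) * (q * z) * 1 := by
          rw [mul_one]
          gcongr
      _ ≤ z ^ (-α) * (q * z) * (Real.exp 1 * Real.exp (-(q * z))) := by gcongr
      _ = Real.exp 1 * q * (z ^ (1 - α) * Real.exp (-(q * z))) := by rw [h4]; ring
      _ ≤ _ := le_add_of_nonneg_left (by positivity)

/-- The contribution of the perturbation `W` to the equation for the Laplace transform. -/
def interaction (ν : Measure ℝ) (W : ℝ → ℝ → ℝ) (q : ℝ) : ℝ≥0∞ :=
  ∫⁻ y, ∫⁻ z, ENNReal.ofReal (W y z) * ENNReal.ofReal (y * Real.exp (-(q * y))) *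
    ENNReal.ofReal (1 - Real.exp (-(q * z))) ∂ν ∂ν

/-- The bound on `W` separates the variables into two products of moments, with exponents `(ρ-1-α) +
(ρ+1-b)` and `(ρ-b) + (ρ-α)`, both equal to `2ρ-α-b`. Restricting to `q ≤ q₀` allows higher powers
of `q` to be absorbed into the constant. -/
lemma exists_interaction_le {ρ α b q₀ : ℝ} (hρ0 : 0 < ρ) (hρ : ρ < 1) (hα0 : 0 ≤ α) (hα : α < ρ)
    (hρb : ρ < b) (hb : b ≤ 1) (hαb : 1 - α ≤ b) (hq₀ : 0 < q₀) :
    ∃ C : ℝ, 0 < C ∧ ∀ (ν : Measure ℝ) [SFinite ν], (∀ᵐ x ∂ν, 0 < x) →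
      (∀ q : ℝ, 0 < q → ∫⁻ x, ENNReal.ofReal (x * Real.exp (-(q * x))) ∂ν ≤
        ENNReal.ofReal (ρ ^ 2 * q ^ (ρ - 1))) → ν univ ≤ 1 → ∀ W : ℝ → ℝ → ℝ,
      (∀ x y : ℝ, 0 < x → 0 < y → W x y ≤ (x / y) ^ α + (y / x) ^ α) →
      ∀ q, 0 < q → q ≤ q₀ → interaction ν W q ≤ ENNReal.ofReal (C * q ^ (2 * ρ - α - b)) := by
  have hbρ : 0 < b - ρ := by linarith
  have hρα : 0 < ρ - α := by linarith
  set C₁ : ℝ := q₀ ^ (b - ρ) + (1 + Real.exp 1 / (b - ρ)) with hC₁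
  set C₂ : ℝ := 1 + 2 / (ρ - α) with hC₂
  have hC₁pos : 0 < C₁ := by positivity
  have hC₂pos : 0 < C₂ := by positivity
  refine ⟨4 * (q₀ ^ (α + b - 1) + Real.exp 1 * C₁) + C₁ * C₂, by positivity, ?_⟩
  intro ν _ hν h hmass W hW q hq hqq
  have hA := lintegral_rpow_one_add_le hν hρ0 hρ hα0 (by linarith) h hq
  have hL0 := fun q hq => lintegral_bernstein_le hν hρ0 h (q := q) hq
  have hD := lintegral_rpow_mul_one_sub_exp_le hν hρ hα0 hα hL0 hq
  have hqb : 0 < q ^ (ρ - b) := Real.rpow_pos_of_pos hq _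
  have hC : ∫⁻ x, ENNReal.ofReal (x ^ (1 - α) * Real.exp (-(q * x))) ∂ν ≤
      ENNReal.ofReal (C₁ * q ^ (ρ - b)) := by
    refine (lintegral_rpow_one_sub_le hν hρ0 hρ (by linarith) hρb hb hαb h hmass hq).trans
      (ENNReal.ofReal_le_ofReal ?_)
    have h1 : 1 ≤ q₀ ^ (b - ρ) * q ^ (ρ - b) := by
      have h2 : q ^ (b - ρ) * q ^ (ρ - b) = 1 := by
        rw [← Real.rpow_add hq]
        simp
      rw [← h2]
      gcongr
    rw [hC₁, add_mul]
    linarith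
  have hB : ∫⁻ z, ENNReal.ofReal (z ^ (-α) * (1 - Real.exp (-(q * z)))) ∂ν ≤
      ENNReal.ofReal ((q₀ ^ (α + b - 1) + Real.exp 1 * C₁) * q ^ (ρ + 1 - b)) := by
    calc _ ≤ ∫⁻ z, (ENNReal.ofReal (q ^ α) * ENNReal.ofReal (1 - Real.exp (-(q * z))) +
          ENNReal.ofReal (Real.exp 1 * q) *
            ENNReal.ofReal (z ^ (1 - α) * Real.exp (-(q * z)))) ∂ν := by
          refine lintegral_mono_ae ?_
          filter_upwards [hν] with z hz
          have h1 : 0 ≤ 1 - Real.exp (-(q * z)) := one_sub_exp_neg_nonneg (mul_pos hq hz).le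
          rw [← ENNReal.ofReal_mul (by positivity), ← ENNReal.ofReal_mul (by positivity),
            ← ENNReal.ofReal_add (by positivity) (by positivity)]
          exact ENNReal.ofReal_le_ofReal (rpow_neg_mul_one_sub_exp_le hα0 hq hz)
      _ ≤ ENNReal.ofReal (q ^ α) * ENNReal.ofReal (ρ * q ^ ρ) +
          ENNReal.ofReal (Real.exp 1 * q) * ENNReal.ofReal (C₁ * q ^ (ρ - b)) := by
          rw [lintegral_add_left (by fun_prop), lintegral_const_mul' _ _ ENNReal.ofReal_ne_top,
            lintegral_const_mul' _ _ ENNReal.ofReal_ne_top]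
          gcongr
          exact hL0 q hq
      _ ≤ _ := by
          rw [← ENNReal.ofReal_mul (by positivity), ← ENNReal.ofReal_mul (by positivity),
            ← ENNReal.ofReal_add (by positivity) (by positivity)]
          refine ENNReal.ofReal_le_ofReal ?_
          have e1 : q ^ (ρ + 1 - b) = q * q ^ (ρ - b) := by
            rw [show ρ + 1 - b = 1 + (ρ - b) by ring, Real.rpow_add hq, Real.rpow_one]
          have e2 : q ^ α * q ^ ρ = q ^ (α + b - 1) * q ^ (ρ + 1 - b) := by
            rw [← Real.rpow_add hq, ← Real.rpow_add hq]
            ring_nf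
          have h3 : q ^ (α + b - 1) ≤ q₀ ^ (α + b - 1) :=
            Real.rpow_le_rpow hq.le hqq (by linarith)
          have h4 : 0 < q ^ (ρ + 1 - b) := Real.rpow_pos_of_pos hq _
          calc q ^ α * (ρ * q ^ ρ) + Real.exp 1 * q * (C₁ * q ^ (ρ - b))
              = ρ * (q ^ (α + b - 1) * q ^ (ρ + 1 - b)) + Real.exp 1 * C₁ * q ^ (ρ + 1 - b) := by
                rw [← e2, e1]
                ring
            _ ≤ 1 * (q₀ ^ (α + b - 1) * q ^ (ρ + 1 - b)) +
                Real.exp 1 * C₁ * q ^ (ρ + 1 - b) := by gcongr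
            _ = _ := by ring
  have hpt : ∀ᵐ y ∂ν, (∫⁻ z, ENNReal.ofReal (W y z) * ENNReal.ofReal (y * Real.exp (-(q * y))) *
      ENNReal.ofReal (1 - Real.exp (-(q * z))) ∂ν) ≤
      ENNReal.ofReal (y ^ (1 + α) * Real.exp (-(q * y))) *
        (∫⁻ z, ENNReal.ofReal (z ^ (-α) * (1 - Real.exp (-(q * z)))) ∂ν) +
      ENNReal.ofReal (y ^ (1 - α) * Real.exp (-(q * y))) *
        ∫⁻ z, ENNReal.ofReal (z ^ α * (1 - Real.exp (-(q * z)))) ∂ν := by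
    filter_upwards [hν] with y hy
    rw [← lintegral_const_mul' _ _ ENNReal.ofReal_ne_top,
      ← lintegral_const_mul' _ _ ENNReal.ofReal_ne_top, ← lintegral_add_left (by fun_prop)]
    refine lintegral_mono_ae ?_
    filter_upwards [hν] with z hz
    have h1 : 0 ≤ 1 - Real.exp (-(q * z)) := one_sub_exp_neg_nonneg (mul_pos hq hz).le
    rw [mul_assoc, ← ENNReal.ofReal_mul (p := y * Real.exp (-(q * y))) (by positivity),
      ← ENNReal.ofReal_mul' (by positivity),
      ← ENNReal.ofReal_mul (p := y ^ (1 + α) * Real.exp (-(q * y))) (by positivity),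
      ← ENNReal.ofReal_mul (p := y ^ (1 - α) * Real.exp (-(q * y))) (by positivity),
      ← ENNReal.ofReal_add (by positivity) (by positivity)]
    refine ENNReal.ofReal_le_ofReal ?_
    have e1 : (y / z) ^ α = y ^ α * z ^ (-α) := by
      rw [Real.div_rpow hy.le hz.le, Real.rpow_neg hz.le, div_eq_mul_inv]
    have e2 : (z / y) ^ α = z ^ α * y ^ (-α) := by
      rw [Real.div_rpow hz.le hy.le, Real.rpow_neg hy.le, div_eq_mul_inv]
    have e3 : y ^ (1 + α) = y * y ^ α := by rw [Real.rpow_add hy, Real.rpow_one]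
    have e4 : y ^ (1 - α) = y * y ^ (-α) := by
      rw [sub_eq_add_neg, Real.rpow_add hy, Real.rpow_one]
    calc W y z * (y * Real.exp (-(q * y)) * (1 - Real.exp (-(q * z))))
        ≤ ((y / z) ^ α + (z / y) ^ α) *
          (y * Real.exp (-(q * y)) * (1 - Real.exp (-(q * z)))) := by
          gcongr
          exact hW y z hy hz
      _ = _ := by
          rw [e1, e2, e3, e4]
          ring
  refine (lintegral_mono_ae hpt).trans ?_
  rw [lintegral_add_left (by fun_prop), lintegral_mul_const _ (by fun_prop),
    lintegral_mul_const _ (by fun_prop)]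
  refine (add_le_add (mul_le_mul' hA hB) (mul_le_mul' hC hD)).trans ?_
  rw [← ENNReal.ofReal_mul (by positivity), ← ENNReal.ofReal_mul (by positivity),
    ← ENNReal.ofReal_add (by positivity) (by positivity)]
  refine ENNReal.ofReal_le_ofReal (le_of_eq ?_)
  have e1 : q ^ (2 * ρ - α - b) = q ^ (ρ - 1 - α) * q ^ (ρ + 1 - b) := by
    rw [← Real.rpow_add hq]
    ring_nf
  have e2 : q ^ (2 * ρ - α - b) = q ^ (ρ - b) * q ^ (ρ - α) := by
    rw [← Real.rpow_add hq]
    ring_nf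
  linear_combination (-4 * (q₀ ^ (α + b - 1) + Real.exp 1 * C₁)) * e1 - C₁ * C₂ * e2

/-! ### Profiles give subsolutions -/

lemma ofReal_expMoment {ν : Measure ℝ} (hν : ∀ᵐ x ∂ν, 0 < x) {n : ℕ} {q : ℝ}
    (h : Integrable (fun x => x ^ n * Real.exp (-(q * x))) ν) :
    ENNReal.ofReal (expMoment ν n q) = ∫⁻ x, ENNReal.ofReal (x ^ n * Real.exp (-(q * x))) ∂ν := by
  refine ofReal_integral_eq_lintegral_ofReal h ?_
  filter_upwards [hν] with x hx
  positivity

lemma ofReal_bernstein {ν : Measure ℝ} (hν : ∀ᵐ x ∂ν, 0 < x) {q : ℝ} (hq : 0 < q)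
    (h : Integrable (fun x => 1 - Real.exp (-(q * x))) ν) :
    ENNReal.ofReal (bernstein ν q) = ∫⁻ x, ENNReal.ofReal (1 - Real.exp (-(q * x))) ∂ν := by
  refine ofReal_integral_eq_lintegral_ofReal h ?_
  filter_upwards [hν] with x hx
  exact one_sub_exp_neg_nonneg (mul_pos hq hx).le

lemma lintegral_perturbed_kernel {ν : Measure ℝ} (hν : ∀ᵐ x ∂ν, 0 < x) {α ε : ℝ}
    {W : ℝ → ℝ → ℝ} (hW : IsPerturbationKernel α W) (hε : 0 ≤ ε) (q : ℝ) :
    ∫⁻ y, ∫⁻ z, ENNReal.ofReal (coagulationKernel ε W y z) *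
        ENNReal.ofReal (y * Real.exp (-(q * y))) *
        ENNReal.ofReal (1 - Real.exp (-(q * z))) ∂ν ∂ν =
      2 * (∫⁻ x, ENNReal.ofReal (x * Real.exp (-(q * x))) ∂ν) *
        (∫⁻ x, ENNReal.ofReal (1 - Real.exp (-(q * x))) ∂ν) +
      ENNReal.ofReal ε * interaction ν W q := by
  have h1 : ∀ᵐ y ∂ν, (∫⁻ z, ENNReal.ofReal (coagulationKernel ε W y z) *
        ENNReal.ofReal (y * Real.exp (-(q * y))) *
        ENNReal.ofReal (1 - Real.exp (-(q * z))) ∂ν) =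
      2 * ENNReal.ofReal (y * Real.exp (-(q * y))) *
        (∫⁻ z, ENNReal.ofReal (1 - Real.exp (-(q * z))) ∂ν) +
      ENNReal.ofReal ε * ∫⁻ z, ENNReal.ofReal (W y z) * ENNReal.ofReal (y * Real.exp (-(q * y))) *
        ENNReal.ofReal (1 - Real.exp (-(q * z))) ∂ν := by
    filter_upwards [hν] with y hy
    rw [← lintegral_const_mul' _ _ (ENNReal.mul_ne_top ENNReal.ofNat_ne_top ENNReal.ofReal_ne_top),
      ← lintegral_const_mul' _ _ ENNReal.ofReal_ne_top, ← lintegral_add_left (by fun_prop)]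
    refine lintegral_congr_ae ?_
    filter_upwards [hν] with z hz
    rw [coagulationKernel, ENNReal.ofReal_add two_pos.le (mul_nonneg hε (hW.nonneg y z hy hz)),
      ENNReal.ofReal_mul hε, ENNReal.ofReal_ofNat]
    ring
  rw [lintegral_congr_ae h1, lintegral_add_left (by fun_prop),
    lintegral_mul_const _ (by fun_prop), lintegral_const_mul' _ _ ENNReal.ofNat_ne_top,
    lintegral_const_mul' _ _ ENNReal.ofReal_ne_top]
  rfl

/-- Monotone convergence as `q → ∞`. -/
lemma measure_univ_le_of_bernstein_le {ν : Measure ℝ} (hν : ∀ᵐ x ∂ν, 0 < x) {c : ℝ≥0∞}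
    (h : ∀ q : ℝ, 0 < q → ∫⁻ x, ENNReal.ofReal (1 - Real.exp (-(q * x))) ∂ν ≤ c) :
    ν univ ≤ c := by
  have hlim : Tendsto (fun n : ℕ => ∫⁻ x, ENNReal.ofReal (1 - Real.exp (-(((n : ℝ) + 1) * x))) ∂ν)
      atTop (nhds (∫⁻ _, 1 ∂ν)) := by
    refine lintegral_tendsto_of_tendsto_of_monotone (fun n => by fun_prop) ?_ ?_
    · filter_upwards [hν] with x hx n k hnk
      have : (n : ℝ) ≤ k := by exact_mod_cast hnk
      dsimp only
      gcongr
    · filter_upwards [hν] with x hx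
      rw [← ENNReal.ofReal_one]
      refine (ENNReal.continuous_ofReal.tendsto 1).comp ?_
      have h1 : Tendsto (fun n : ℕ => ((n : ℝ) + 1) * x) atTop atTop :=
        (tendsto_atTop_add_const_right _ _ tendsto_natCast_atTop_atTop).atTop_mul_const hx
      simpa using (Real.tendsto_exp_neg_atTop_nhds_zero.comp h1).const_sub 1
  rw [← lintegral_one]
  exact le_of_tendsto' hlim fun n => h _ (by positivity)

lemma integrable_exp_of_first_le {ν : Measure ℝ} (hν : ∀ᵐ x ∂ν, 0 < x) {ρ : ℝ}
    (h : ∀ q : ℝ, 0 < q → ∫⁻ x, ENNReal.ofReal (x * Real.exp (-(q * x))) ∂ν ≤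
      ENNReal.ofReal (ρ ^ 2 * q ^ (ρ - 1))) {q : ℝ} (hq : 0 < q) :
    Integrable (fun x => x ^ 1 * Real.exp (-(q * x))) ν := by
  simp only [pow_one]
  refine integrable_of_lintegral_ofReal_le (by fun_prop) ?_ (h q hq)
  filter_upwards [hν] with x hx
  positivity

lemma integrable_one_sub_exp {ν : Measure ℝ} [SFinite ν] (hν : ∀ᵐ x ∂ν, 0 < x) {ρ : ℝ}
    (hρ : 0 < ρ) (h : ∀ q : ℝ, 0 < q → ∫⁻ x, ENNReal.ofReal (x * Real.exp (-(q * x))) ∂ν ≤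
      ENNReal.ofReal (ρ ^ 2 * q ^ (ρ - 1))) {q : ℝ} (hq : 0 < q) :
    Integrable (fun x => 1 - Real.exp (-(q * x))) ν := by
  refine integrable_of_lintegral_ofReal_le (by fun_prop) ?_ (lintegral_bernstein_le hν hρ h hq)
  filter_upwards [hν] with x hx
  exact one_sub_exp_neg_nonneg (mul_pos hq hx).le

lemma particleMeasure_ne_zero {ρ α : ℝ} {K : ℝ → ℝ → ℝ} {f : ℝ → ℝ}
    (hf : IsSelfSimilarProfile ρ α K f) : particleMeasure f ≠ 0 := by
  intro h
  refine hf.ne_zero ?_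
  rw [particleMeasure, withDensity_eq_zero_iff
    hf.locallyIntegrableOn.aestronglyMeasurable.aemeasurable.ennreal_ofReal] at h
  filter_upwards [h, hf.nonneg] with x hx hx0
  exact le_antisymm (ENNReal.ofReal_eq_zero.1 hx) hx0

lemma expMoment_pos {ν : Measure ℝ} (hν : ∀ᵐ x ∂ν, 0 < x) (h0 : ν ≠ 0) {n : ℕ} {q : ℝ}
    (h : Integrable (fun x => x ^ n * Real.exp (-(q * x))) ν) : 0 < expMoment ν n q := by
  have hnn : 0 ≤ᵐ[ν] fun x => x ^ n * Real.exp (-(q * x)) := by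
    filter_upwards [hν] with x hx
    positivity
  refine lt_of_le_of_ne (integral_nonneg_of_ae hnn) fun he => h0 ?_
  have h1 := (integral_eq_zero_iff_of_nonneg_ae hnn h).1 he.symm
  rw [← ae_eq_bot, ← eventually_false_iff_eq_bot]
  filter_upwards [h1, hν] with x hx hx0
  have : 0 < x ^ n * Real.exp (-(q * x)) := by positivity
  exact this.ne' hx

/-- The transformed equation holds in `[0,∞]`; its left side is finite, so the finite terms can be
moved across. This also shows that `ε` times the interaction is finite. -/
lemma defect_eq {ρ α β ε : ℝ} {W : ℝ → ℝ → ℝ} {f : ℝ → ℝ} (hρ0 : 0 < ρ) (hρ : ρ < 1)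
    (hε : 0 ≤ ε) (hW : IsPerturbationKernel α W)
    (hf : IsSelfSimilarProfile ρ β (coagulationKernel ε W) f) (hn : IsNormalised ρ f) {q : ℝ}
    (hq : 0 < q) :
    0 ≤ q * expMoment (particleMeasure f) 2 q - (1 - ρ) * expMoment (particleMeasure f) 1 q -
        2 * bernstein (particleMeasure f) q * expMoment (particleMeasure f) 1 q ∧
      ENNReal.ofReal (q * expMoment (particleMeasure f) 2 q -
        (1 - ρ) * expMoment (particleMeasure f) 1 q -
        2 * bernstein (particleMeasure f) q * expMoment (particleMeasure f) 1 q) =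
      ENNReal.ofReal ε * interaction (particleMeasure f) W q := by
  set ν := particleMeasure f with hνdef
  have hν : ∀ᵐ x ∂ν, 0 < x := ae_pos_particleMeasure f
  have h1 := fun q hq => lintegral_first_le hρ hf hn (q := q) hq
  have i1 := fun q hq => integrable_exp_of_first_le hν h1 (q := q) hq
  have i2 := integrable_pow_succ_mul_exp hν i1 hq
  have i0 := integrable_one_sub_exp hν hρ0 h1 hq
  have hK : ContinuousOn (Function.uncurry (coagulationKernel ε W)) (Ioi 0 ×ˢ Ioi 0) :=
    continuousOn_const.add (continuousOn_const.mul hW.continuousOn)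
  have heq := profile_equation_laplace hf hK
    (fun x y hx hy => add_nonneg two_pos.le (mul_nonneg hε (hW.nonneg x y hx hy))) hq
  rw [← hνdef, lintegral_perturbed_kernel hν hW hε, ← ofReal_bernstein hν hq i0,
    ← ofReal_expMoment hν i2] at heq
  have e1 := ofReal_expMoment hν (i1 q hq)
  simp only [pow_one] at e1
  have p1 : 0 ≤ expMoment ν 1 q := by
    refine integral_nonneg_of_ae ?_
    filter_upwards [hν] with x hx
    positivity
  have p0 : 0 ≤ bernstein ν q := by
    refine integral_nonneg_of_ae ?_
    filter_upwards [hν] with x hx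
    exact one_sub_exp_neg_nonneg (mul_pos hq hx).le
  have hρ' : 0 ≤ 1 - ρ := by linarith
  rw [← e1, ← ENNReal.ofReal_ofNat, ← ENNReal.ofReal_mul hq.le, ← ENNReal.ofReal_mul hρ',
    ← ENNReal.ofReal_mul two_pos.le, ← ENNReal.ofReal_mul (by positivity), ← add_assoc,
    ← ENNReal.ofReal_add (by positivity) (by positivity)] at heq
  set S := (1 - ρ) * expMoment ν 1 q + 2 * expMoment ν 1 q * bernstein ν q with hS
  have hS0 : 0 ≤ S := by positivity
  have e2 : q * expMoment ν 2 q - (1 - ρ) * expMoment ν 1 q -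
      2 * bernstein ν q * expMoment ν 1 q = q * expMoment ν 2 q - S := by
    rw [hS]
    ring
  rw [e2]
  have p2 : 0 ≤ q * expMoment ν 2 q := by
    refine mul_nonneg hq.le (integral_nonneg_of_ae ?_)
    filter_upwards [hν] with x hx
    positivity
  refine ⟨?_, ?_⟩
  · rw [sub_nonneg, ← ENNReal.ofReal_le_ofReal_iff p2]
    exact le_of_le_of_eq le_self_add heq.symm
  · rw [ENNReal.ofReal_sub _ hS0, heq, ENNReal.add_sub_cancel_left ENNReal.ofReal_ne_top]

lemma logisticSubsolution_of_profile {ρ α β ε : ℝ} {W : ℝ → ℝ → ℝ} {f : ℝ → ℝ} (hρ0 : 0 < ρ)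
    (hρ : ρ < 1) (hε : 0 ≤ ε) (hW : IsPerturbationKernel α W)
    (hf : IsSelfSimilarProfile ρ β (coagulationKernel ε W) f) (hn : IsNormalised ρ f) :
    LogisticSubsolution ρ (bernstein (particleMeasure f)) (expMoment (particleMeasure f) 1)
      (expMoment (particleMeasure f) 2) := by
  set ν := particleMeasure f with hνdef
  have hν : ∀ᵐ x ∂ν, 0 < x := ae_pos_particleMeasure f
  have h1 := fun q hq => lintegral_first_le hρ hf hn (q := q) hq
  have i1 := fun q hq => integrable_exp_of_first_le hν h1 (q := q) hq
  have i0 := fun q hq => integrable_one_sub_exp hν hρ0 h1 (q := q) hq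
  have e1 : ∀ q : ℝ, 0 < q → ENNReal.ofReal (expMoment ν 1 q) =
      ∫⁻ x, ENNReal.ofReal (x * Real.exp (-(q * x))) ∂ν := by
    intro q hq
    simpa only [pow_one] using ofReal_expMoment hν (i1 q hq)
  have pos1 : ∀ q, 0 < q → 0 < expMoment ν 1 q :=
    fun q hq => expMoment_pos hν (particleMeasure_ne_zero hf) (i1 q hq)
  refine ⟨fun q hq => hasDerivAt_bernstein hν i1 i0 hq, fun q hq => hasDerivAt_expMoment hν i1 hq,
    fun q hq => ?_, pos1, fun q hq => ?_, fun q hq => ?_, fun η hη0 hη => ?_,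
    fun q hq => (defect_eq hρ0 hρ hε hW hf hn hq).1⟩
  · refine integral_nonneg_of_ae ?_
    filter_upwards [hν] with x hx
    exact one_sub_exp_neg_nonneg (mul_pos hq hx).le
  · rw [← ENNReal.ofReal_le_ofReal_iff (by positivity), ofReal_bernstein hν hq (i0 q hq)]
    exact lintegral_bernstein_le hν hρ0 h1 hq
  · rw [← ENNReal.ofReal_le_ofReal_iff (by positivity), e1 q hq]
    exact h1 q hq
  -- The gap `η' - η` absorbs the constant of the Abelian lower bound, as `q^(1-ρ) → 0`.
  · set η' := (1 + η) / 2 with hη'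
    obtain ⟨C, hC⟩ := le_lintegral_first (η := η') hρ0 hρ hf hn (by linarith) (by linarith)
    have hlim := tendsto_mul_rpow_nhdsGT_zero (η' * C) (a := 1 - ρ) (by linarith)
    have hev := hlim.eventually_lt_const (u := (η' - η) * ρ ^ 2)
      (mul_pos (by linarith) (by positivity))
    filter_upwards [hev, self_mem_nhdsWithin] with q hq hq0
    have hq0 : 0 < q := hq0
    have h2 := hC q hq0
    rw [← e1 q hq0] at h2
    have h3 := (ENNReal.ofReal_le_ofReal_iff (pos1 q hq0).le).1 h2
    refine le_trans ?_ h3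
    have hp : 0 < q ^ (ρ - 1) := Real.rpow_pos_of_pos hq0 _
    have e : q ^ (1 - ρ) * q ^ (ρ - 1) = 1 := by
      rw [← Real.rpow_add hq0]
      simp
    have h4 := mul_le_mul_of_nonneg_right hq.le hp.le
    have h5 : η' * C * q ^ (1 - ρ) * q ^ (ρ - 1) = η' * C := by rw [mul_assoc, e, mul_one]
    rw [h5] at h4
    linarith

lemma measure_univ_particleMeasure_le {ρ α β ε : ℝ} {W : ℝ → ℝ → ℝ} {f : ℝ → ℝ} (hρ0 : 0 < ρ)
    (hρ : ρ < 1) (hε : 0 ≤ ε) (hW : IsPerturbationKernel α W)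
    (hf : IsSelfSimilarProfile ρ β (coagulationKernel ε W) f) (hn : IsNormalised ρ f) :
    particleMeasure f univ ≤ ENNReal.ofReal ρ := by
  have hν := ae_pos_particleMeasure f
  have h1 := fun q hq => lintegral_first_le hρ hf hn (q := q) hq
  refine measure_univ_le_of_bernstein_le hν fun q hq => ?_
  rw [← ofReal_bernstein hν hq (integrable_one_sub_exp hν hρ0 h1 hq)]
  exact ENNReal.ofReal_le_ofReal
    ((logisticSubsolution_of_profile hρ0 hρ hε hW hf hn).lt_rho hρ0 hq).le

/-! ### Laplace transforms of finite measures -/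

lemma integrable_exp_neg_mul {ν : Measure ℝ} [IsFiniteMeasure ν] (hν : ∀ᵐ x ∂ν, 0 < x) {q : ℝ}
    (hq : 0 ≤ q) : Integrable (fun x => x ^ 0 * Real.exp (-(q * x))) ν := by
  refine (integrable_const (1 : ℝ)).mono' (by fun_prop) ?_
  filter_upwards [hν] with x hx
  rw [pow_zero, one_mul, Real.norm_of_nonneg (Real.exp_pos _).le, Real.exp_le_one_iff]
  nlinarith [mul_nonneg hq hx.le]

lemma expMoment_zero_eq {ν : Measure ℝ} [IsFiniteMeasure ν] (hν : ∀ᵐ x ∂ν, 0 < x) {q : ℝ}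
    (hq : 0 ≤ q) : expMoment ν 0 q = ν.real univ - bernstein ν q := by
  have h := integrable_exp_neg_mul hν hq
  simp only [pow_zero, one_mul] at h
  rw [bernstein, integral_sub (integrable_const _) h, expMoment]
  simp

lemma continuousOn_expMoment_zero {ν : Measure ℝ} [IsFiniteMeasure ν] (hν : ∀ᵐ x ∂ν, 0 < x) :
    ContinuousOn (expMoment ν 0) (Ici 0) := by
  refine continuousOn_of_dominated (bound := fun _ => 1) (fun q _ => by fun_prop)
    (fun q hq => ?_) (integrable_const _) (Eventually.of_forall fun x => by fun_prop)
  filter_upwards [hν] with x hx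
  rw [pow_zero, one_mul, Real.norm_of_nonneg (Real.exp_pos _).le, Real.exp_le_one_iff]
  nlinarith [mul_nonneg (mem_Ici.1 hq) hx.le]

lemma tendsto_bernstein {ν : Measure ℝ} [IsFiniteMeasure ν] (hν : ∀ᵐ x ∂ν, 0 < x) :
    Tendsto (bernstein ν) atTop (nhds (ν.real univ)) := by
  have h : Tendsto (bernstein ν) atTop (nhds (∫ _, (1 : ℝ) ∂ν)) := by
    refine tendsto_integral_filter_of_dominated_convergence (fun _ => 1)
      (Eventually.of_forall fun q => by fun_prop) ?_ (integrable_const _) ?_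
    · filter_upwards [eventually_ge_atTop 0] with q hq
      filter_upwards [hν] with x hx
      rw [Real.norm_of_nonneg (one_sub_exp_neg_nonneg (mul_nonneg hq hx.le))]
      linarith [Real.exp_pos (-(q * x))]
    · filter_upwards [hν] with x hx
      simpa using (Real.tendsto_exp_neg_atTop_nhds_zero.comp
        (tendsto_id.atTop_mul_const hx)).const_sub 1
  simpa using h

/-- With `t = qx/4 ≤ e^t`, `(qx)^n = (4t)^n ≤ 16 e^{2t}` for `n ≤ 2`. Decay of the transform thus
passes to its derivatives, at the price of halving `q`. -/
lemma expMoment_le {ν : Measure ℝ} [IsFiniteMeasure ν] (hν : ∀ᵐ x ∂ν, 0 < x) {n : ℕ}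
    (hn : n ≤ 2) {q : ℝ} (hq : 0 < q) :
    q ^ n * expMoment ν n q ≤ 16 * expMoment ν 0 (q / 2) := by
  rw [expMoment, expMoment, ← integral_const_mul, ← integral_const_mul]
  have hq2 := integrable_exp_neg_mul hν (q := q / 2) (by positivity)
  refine integral_mono_of_nonneg ?_ (hq2.const_mul 16) ?_
  · filter_upwards [hν] with x hx
    positivity
  · filter_upwards [hν] with x hx
    have h0 : 0 < q / 4 * x := by positivity
    have h1 : q / 4 * x ≤ Real.exp (q / 4 * x) := by
      linarith [Real.add_one_le_exp (q / 4 * x)]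
    have h2 : (1 : ℝ) ≤ Real.exp (q / 4 * x) := Real.one_le_exp h0.le
    have h3 : (q * x) ^ n ≤ 16 * (Real.exp (q / 4 * x) * Real.exp (q / 4 * x)) := by
      interval_cases n <;> nlinarith
    calc q ^ n * (x ^ n * Real.exp (-(q * x))) = (q * x) ^ n * Real.exp (-(q * x)) := by
          rw [mul_pow]; ring
      _ ≤ 16 * (Real.exp (q / 4 * x) * Real.exp (q / 4 * x)) * Real.exp (-(q * x)) := by gcongr
      _ = 16 * (x ^ 0 * Real.exp (-(q / 2 * x))) := by
          rw [← Real.exp_add, mul_assoc, ← Real.exp_add, pow_zero, one_mul]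
          ring_nf

lemma laplace_eq_expMoment {f : ℝ → ℝ} (hf : LocallyIntegrableOn f (Ioi 0))
    (hnn : ∀ᵐ x ∂(volume.restrict (Ioi (0 : ℝ))), 0 ≤ f x) (q : ℝ) :
    laplace f q = expMoment (particleMeasure f) 0 q := by
  rw [expMoment, particleMeasure, integral_withDensity_eq_integral_toReal_smul₀
    hf.aestronglyMeasurable.aemeasurable.ennreal_ofReal
    (Eventually.of_forall fun _ => ENNReal.ofReal_lt_top)]
  refine integral_congr_ae ?_
  filter_upwards [hnn] with x hx
  simp [ENNReal.toReal_ofReal hx]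

lemma integrableOn_of_measure_univ_lt_top {f : ℝ → ℝ} (hf : LocallyIntegrableOn f (Ioi 0))
    (hnn : ∀ᵐ x ∂(volume.restrict (Ioi (0 : ℝ))), 0 ≤ f x) (h : particleMeasure f univ < ∞) :
    IntegrableOn f (Ioi 0) := by
  refine ⟨hf.aestronglyMeasurable, (hasFiniteIntegral_iff_ofReal hnn).2 ?_⟩
  rwa [particleMeasure, withDensity_apply _ MeasurableSet.univ, Measure.restrict_univ] at h

/-! ### Closeness of the profiles -/

/-- For `q ≥ 1` the weight is comparable to `q^(θ+l)`, with the factor `2^3` from `1 + q ≤ 2q`.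
Taking `μ = -ρ` covers the zeroth-order term. -/
lemma weight_mul_le {ρ μ θ q Y : ℝ} {l : ℕ} {X : ℝ} (hq : 1 ≤ q) (hw0 : 0 ≤ θ + μ + ρ)
    (hw : θ + μ + ρ ≤ 3) (hX : 0 ≤ X) (h : q ^ θ * (q ^ l * X) ≤ Y) :
    (1 + q) ^ (θ + μ + ρ) * q ^ ((l : ℝ) - ρ - μ) * X ≤ 8 * Y := by
  have hq0 : 0 < q := by linarith
  have h1 : (1 + q) ^ (θ + μ + ρ) ≤ 8 * q ^ (θ + μ + ρ) := by
    calc (1 + q) ^ (θ + μ + ρ) ≤ (2 * q) ^ (θ + μ + ρ) :=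
          Real.rpow_le_rpow (by linarith) (by linarith) hw0
      _ = 2 ^ (θ + μ + ρ) * q ^ (θ + μ + ρ) := Real.mul_rpow two_pos.le hq0.le
      _ ≤ 2 ^ (3 : ℝ) * q ^ (θ + μ + ρ) := by
          gcongr
          exact one_le_two
      _ = 8 * q ^ (θ + μ + ρ) := by norm_num
  have h2 : q ^ (θ + μ + ρ) * q ^ ((l : ℝ) - ρ - μ) = q ^ θ * q ^ l := by
    rw [← Real.rpow_natCast q l, ← Real.rpow_add hq0, ← Real.rpow_add hq0]
    ring_nf
  calc (1 + q) ^ (θ + μ + ρ) * q ^ ((l : ℝ) - ρ - μ) * X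
      ≤ 8 * q ^ (θ + μ + ρ) * q ^ ((l : ℝ) - ρ - μ) * X := by gcongr
    _ = 8 * (q ^ θ * (q ^ l * X)) := by
        rw [mul_assoc 8, h2]
        ring
    _ ≤ 8 * Y := by gcongr

/-- Tail decay at `q/2`, transferred to the moment of order `n`; `64 = 2 · 16 · 2`, the first factor
comparing `q^θ` with `(q/2)^θ`. -/
lemma rpow_mul_expMoment_le {ν : Measure ℝ} [IsFiniteMeasure ν] (hν : ∀ᵐ x ∂ν, 0 < x)
    {ρ θ q₀ η : ℝ} {Q₁ Q₂ : ℝ → ℝ} (h : LogisticSubsolution ρ (bernstein ν) Q₁ Q₂)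
    (hθ1 : θ ≤ 1) (hq₀ : 0 < q₀) (hθ : θ ≤ ν.real univ + bernstein ν q₀ - ρ)
    (hη : q₀ ^ θ * (ν.real univ - bernstein ν q₀) ≤ 2 * η) {n : ℕ} (hn : n ≤ 2) {q : ℝ}
    (hq : 2 * q₀ ≤ q) : q ^ θ * (q ^ n * expMoment ν n q) ≤ 64 * η := by
  have hq0 : 0 < q := by linarith
  have h1 := h.rpow_mul_tail_le (tendsto_bernstein hν) hq₀ hθ (q := q / 2) (by linarith)
  rw [← expMoment_zero_eq hν (by positivity)] at h1
  have h2 := expMoment_le hν hn hq0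
  have h3 : q ^ θ ≤ 2 * (q / 2) ^ θ := by
    calc q ^ θ = 2 ^ θ * (q / 2) ^ θ := by
          rw [← Real.mul_rpow two_pos.le (by positivity)]
          ring_nf
      _ ≤ 2 ^ (1 : ℝ) * (q / 2) ^ θ := by
          gcongr
          exact one_le_two
      _ = _ := by rw [Real.rpow_one]
  have h4 : 0 ≤ expMoment ν 0 (q / 2) := by
    refine integral_nonneg_of_ae ?_
    filter_upwards [hν] with x hx
    positivity
  calc q ^ θ * (q ^ n * expMoment ν n q) ≤ q ^ θ * (16 * expMoment ν 0 (q / 2)) := by gcongr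
    _ ≤ 2 * (q / 2) ^ θ * (16 * expMoment ν 0 (q / 2)) := by gcongr
    _ = 32 * ((q / 2) ^ θ * expMoment ν 0 (q / 2)) := by ring
    _ ≤ 32 * (2 * η) := by linarith
    _ = 64 * η := by ring

/-- Lets the constant kernel be treated as the case `ε = 0`, so that `fbar` is covered by the same
lemmas as `f`. -/
lemma isPerturbationKernel_zero : IsPerturbationKernel 0 fun _ _ => 0 :=
  ⟨continuousOn_const, fun _ _ _ _ => rfl, fun _ _ _ _ _ _ => rfl, fun _ _ _ _ => le_rfl,
    fun _ _ _ _ => by simp⟩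

lemma coagulationKernel_zero : coagulationKernel 0 (fun _ _ => 0) = constantKernel := by
  funext x y
  simp [coagulationKernel, constantKernel]

lemma exists_uniform_comparison {α ρ μ q₀ : ℝ} (hα : 0 ≤ α) (hρ0 : 0 < ρ) (hρ : ρ < 1)
    (hαρ : α < ρ) (hμ : μ ∈ Ico 0 (min ρ (1 - ρ))) (hq₀ : 0 < q₀)
    {W : ℝ → ℝ → ℝ} (hW : IsPerturbationKernel α W) {fbar : ℝ → ℝ}
    (hfbar : IsSelfSimilarProfile ρ 0 constantKernel fbar) (hfbar_norm : IsNormalised ρ fbar) :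
    ∃ κ C : ℝ, μ ≤ κ ∧ 0 < κ ∧ 0 < C ∧ ∀ ε : ℝ, 0 < ε → ∀ f : ℝ → ℝ,
      IsSelfSimilarProfile ρ α (coagulationKernel ε W) f → IsNormalised ρ f →
      ∀ q, 0 < q → q ≤ q₀ →
        |bernstein (particleMeasure fbar) q - bernstein (particleMeasure f) q| ≤
          ε * C * q ^ (ρ + κ) ∧
        |expMoment (particleMeasure fbar) 1 q - expMoment (particleMeasure f) 1 q| ≤
          ε * C * q ^ (ρ + κ - 1) ∧
        |expMoment (particleMeasure fbar) 2 q - expMoment (particleMeasure f) 2 q| ≤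
          ε * C * q ^ (ρ + κ - 2) := by
  obtain ⟨hμ0, hμ1⟩ := hμ
  obtain ⟨hμρ, hμρ'⟩ := lt_min_iff.1 hμ1
  obtain ⟨ν, hμν, hνρ, hνρ', hν0⟩ : ∃ ν : ℝ, μ < ν ∧ ν < ρ ∧ ν < 1 - ρ ∧ 0 < ν := by
    obtain ⟨ν, h1, h2⟩ := exists_between hμ1
    exact ⟨ν, h1, (lt_min_iff.1 h2).1, (lt_min_iff.1 h2).2, by linarith⟩
  -- The gain is `κ = ρ + 1 - α - b`, so `κ ≥ ν > μ` needs `b ≤ ρ + 1 - α - ν`. The constraint `b >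
  -- ρ` uses `α < ρ` and `ν < 1 - ρ`; the constraint `b ≥ 1 - α` uses `ν < ρ`.
  set b := min 1 (ρ + 1 - α - ν) with hb
  have hb1 : b ≤ 1 := min_le_left _ _
  have hb2 : b ≤ ρ + 1 - α - ν := min_le_right _ _
  have hρb : ρ < b := lt_min hρ (by linarith)
  have hαb : 1 - α ≤ b := le_min (by linarith) (by linarith)
  obtain ⟨C₁, hC₁, hint⟩ := exists_interaction_le hρ0 hρ hα hαρ hρb hb1 hαb hq₀
  have hκ : 0 < ρ + 1 - α - b := by linarith
  obtain ⟨C₂, hC₂, hcomp⟩ := LogisticSubsolution.exists_comparison hρ0 hρ hκ hq₀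
  refine ⟨ρ + 1 - α - b, C₂ * C₁, by linarith, hκ, by positivity, ?_⟩
  intro ε hε f hf hn q hq hqq
  rw [← coagulationKernel_zero] at hfbar
  have hR := logisticSubsolution_of_profile hρ0 hρ le_rfl isPerturbationKernel_zero hfbar hfbar_norm
  have hQ := logisticSubsolution_of_profile hρ0 hρ hε.le hW hf hn
  have hmass : particleMeasure f univ ≤ 1 :=
    (measure_univ_particleMeasure_le hρ0 hρ hε.le hW hf hn).trans (by simpa using hρ.le)
  have hR0 : ∀ q, 0 < q → q * expMoment (particleMeasure fbar) 2 q -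
      (1 - ρ) * expMoment (particleMeasure fbar) 1 q -
      2 * bernstein (particleMeasure fbar) q * expMoment (particleMeasure fbar) 1 q = 0 := by
    intro q hq
    have h := defect_eq hρ0 hρ le_rfl isPerturbationKernel_zero hfbar hfbar_norm hq
    rw [ENNReal.ofReal_zero, zero_mul, ENNReal.ofReal_eq_zero] at h
    exact le_antisymm h.2 h.1
  have hA : ∀ q, 0 < q → q ≤ q₀ → q * expMoment (particleMeasure f) 2 q -
      (1 - ρ) * expMoment (particleMeasure f) 1 q -
      2 * bernstein (particleMeasure f) q * expMoment (particleMeasure f) 1 q ≤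
      (ε * C₁) * q ^ (ρ + (ρ + 1 - α - b) - 1) := by
    intro q hq hqq
    have h := (defect_eq hρ0 hρ hε.le hW hf hn hq).2
    rw [← ENNReal.ofReal_le_ofReal_iff (by positivity), h, mul_assoc, ENNReal.ofReal_mul hε.le,
      show ρ + (ρ + 1 - α - b) - 1 = 2 * ρ - α - b by ring]
    gcongr
    exact hint _ (ae_pos_particleMeasure f) (fun q hq => lintegral_first_le hρ hf hn hq) hmass W
      hW.le_bound q hq hqq
  have h := hcomp hQ hR hR0 _ hA q hq hqq
  have e : C₂ * (ε * C₁) = ε * (C₂ * C₁) := by ring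
  rwa [e] at h

/-- Uniform closeness of the exponential moments of `f` and `fbar`. -/
lemma exists_moments_close {α ρ θ μ η : ℝ} (hα : 0 ≤ α) (hρ0 : 0 < ρ) (hρ : ρ < 1)
    (hαρ : α < ρ) (hθ0 : 0 ≤ θ) (hμ : μ ∈ Ico 0 (min ρ (1 - ρ)))
    {W : ℝ → ℝ → ℝ} (hW : IsPerturbationKernel α W) {fbar : ℝ → ℝ}
    (hfbar : IsSelfSimilarProfile ρ 0 constantKernel fbar) (hfbar_norm : IsNormalised ρ fbar)
    (hη : 0 < η) (hηρ : 4 * η ≤ ρ - θ) :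
    ∃ ε₀ : ℝ, 0 < ε₀ ∧ ∀ ε : ℝ, 0 < ε → ε ≤ ε₀ → ∀ f : ℝ → ℝ,
      IsSelfSimilarProfile ρ α (coagulationKernel ε W) f → IsNormalised ρ f → ∀ q, 0 < q →
        (1 + q) ^ (θ + -ρ + ρ) * q ^ (((0 : ℕ) : ℝ) - ρ - -ρ) *
          |expMoment (particleMeasure f) 0 q - expMoment (particleMeasure fbar) 0 q| ≤ 1024 * η ∧
        ∀ l : ℕ, 1 ≤ l → l ≤ 2 → (1 + q) ^ (θ + μ + ρ) * q ^ ((l : ℝ) - ρ - μ) *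
          |expMoment (particleMeasure f) l q - expMoment (particleMeasure fbar) l q| ≤
            1024 * η := by
  have hμ0 := hμ.1
  obtain ⟨hμρ, hμρ'⟩ := lt_min_iff.1 hμ.2
  have hfbar' := hfbar
  rw [← coagulationKernel_zero] at hfbar'
  have hR := logisticSubsolution_of_profile hρ0 hρ le_rfl isPerturbationKernel_zero hfbar'
    hfbar_norm
  have hRfin := measure_univ_particleMeasure_le hρ0 hρ le_rfl isPerturbationKernel_zero hfbar'
    hfbar_norm
  have hR0 : ∀ q, 0 < q → q * expMoment (particleMeasure fbar) 2 q -
      (1 - ρ) * expMoment (particleMeasure fbar) 1 q -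
      2 * bernstein (particleMeasure fbar) q * expMoment (particleMeasure fbar) 1 q = 0 := by
    intro q hq
    have h := defect_eq hρ0 hρ le_rfl isPerturbationKernel_zero hfbar' hfbar_norm hq
    rw [ENNReal.ofReal_zero, zero_mul, ENNReal.ofReal_eq_zero] at h
    exact le_antisymm h.2 h.1
  have hνbar := ae_pos_particleMeasure fbar
  set νbar := particleMeasure fbar with hνbardef
  have hfinbar : IsFiniteMeasure νbar := ⟨hRfin.trans_lt ENNReal.ofReal_lt_top⟩
  have hmbar : νbar.real univ ≤ ρ := ENNReal.toReal_le_of_le_ofReal hρ0.le hRfin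
  -- For the explicit solution `ρ - R(q) = ρ / (1 + q^ρ)`, which `q^θ` cannot compensate as `θ < ρ`.
  obtain ⟨q₀, hq₀1, hq₀⟩ : ∃ q₀ : ℝ, 1 ≤ q₀ ∧ q₀ ^ θ * (ρ - bernstein νbar q₀) ≤ η := by
    have hlim : Tendsto (fun q : ℝ => q ^ (-(ρ - θ))) atTop (nhds 0) :=
      tendsto_rpow_neg_atTop (by linarith)
    obtain ⟨q₀, h1, h2⟩ := ((hlim.eventually_le_const hη).and (eventually_ge_atTop 1)).exists
    refine ⟨q₀, h2, le_trans ?_ h1⟩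
    have hq0 : 0 < q₀ := by linarith
    have hp : 0 < q₀ ^ ρ := Real.rpow_pos_of_pos hq0 _
    have e : ρ - ρ * q₀ ^ ρ / (1 + q₀ ^ ρ) = ρ / (1 + q₀ ^ ρ) := by
      field_simp
      ring
    rw [(hR.eq_logistic hρ0 hR0 hq0).1, e, neg_sub, Real.rpow_sub hq0, div_eq_mul_one_div (q₀ ^ θ)]
    refine mul_le_mul_of_nonneg_left ?_ (by positivity)
    gcongr
    linarith
  have hq0 : 0 < q₀ := by linarith
  -- The comparison reaches up to `2 q₀`, because the tail estimates started at `q₀` hold only from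
  -- there on.
  obtain ⟨κ, C, hμκ, hκ, hC, hcomp⟩ := exists_uniform_comparison (q₀ := 2 * q₀) hα hρ0 hρ hαρ hμ
    (by positivity) hW hfbar hfbar_norm
  rw [← hνbardef] at hcomp
  -- The first summand bounds the weight times `q^(κ-μ)` on `(0, 2q₀]`, for the derivatives; the
  -- second handles `q₀^θ |R - Q|`.
  set D := (3 * q₀) ^ (θ + μ + ρ) * (2 * q₀) ^ (κ - μ) + q₀ ^ θ * (2 * q₀) ^ (ρ + κ) with hD
  have hDpos : 0 < D := by positivity
  refine ⟨η / (C * D), by positivity, ?_⟩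
  intro ε hε hεε f hf hn q hq
  have hQ := logisticSubsolution_of_profile hρ0 hρ hε.le hW hf hn
  have hQfin := measure_univ_particleMeasure_le hρ0 hρ hε.le hW hf hn
  have hcomp' := hcomp ε hε f hf hn
  have hν := ae_pos_particleMeasure f
  set ν := particleMeasure f with hνdef
  have hfin : IsFiniteMeasure ν := ⟨hQfin.trans_lt ENNReal.ofReal_lt_top⟩
  have hm : ν.real univ ≤ ρ := ENNReal.toReal_le_of_le_ofReal hρ0.le hQfin
  have hεD : ε * C * D ≤ η := by
    rw [le_div_iff₀ (by positivity)] at hεε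
    linarith
  have hεD1 : ε * C * ((3 * q₀) ^ (θ + μ + ρ) * (2 * q₀) ^ (κ - μ)) ≤ η := by
    have : 0 ≤ ε * C * (q₀ ^ θ * (2 * q₀) ^ (ρ + κ)) := by positivity
    rw [hD, mul_add] at hεD
    linarith
  have hεD2 : ε * C * (q₀ ^ θ * (2 * q₀) ^ (ρ + κ)) ≤ η := by
    have : 0 ≤ ε * C * ((3 * q₀) ^ (θ + μ + ρ) * (2 * q₀) ^ (κ - μ)) := by positivity
    rw [hD, mul_add] at hεD
    linarith
  have hH : ∀ q, 0 < q → q ≤ 2 * q₀ → q₀ ^ θ * |bernstein νbar q - bernstein ν q| ≤ η := by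
    intro q hq hqq
    calc q₀ ^ θ * |bernstein νbar q - bernstein ν q| ≤ q₀ ^ θ * (ε * C * q ^ (ρ + κ)) := by
          gcongr
          exact (hcomp' q hq hqq).1
      _ ≤ q₀ ^ θ * (ε * C * (2 * q₀) ^ (ρ + κ)) := by gcongr
      _ = ε * C * (q₀ ^ θ * (2 * q₀) ^ (ρ + κ)) := by ring
      _ ≤ η := hεD2
  have hσ : q₀ ^ θ * (ρ - bernstein ν q₀) ≤ 2 * η := by
    have h1 := hH q₀ hq0 (by linarith)
    have h2 : q₀ ^ θ * (bernstein νbar q₀ - bernstein ν q₀) ≤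
        q₀ ^ θ * |bernstein νbar q₀ - bernstein ν q₀| := by
      gcongr
      exact le_abs_self _
    linarith
  have hq0θ : 1 ≤ q₀ ^ θ := Real.one_le_rpow hq₀1 hθ0
  have hσ0 : 0 ≤ ρ - bernstein ν q₀ := (sub_pos.2 (hQ.lt_rho hρ0 hq0)).le
  have hσ1 : ρ - bernstein ν q₀ ≤ 2 * η :=
    (le_mul_of_one_le_left hσ0 hq0θ).trans hσ
  have hQR : bernstein ν q₀ ≤ bernstein νbar q₀ := by
    rw [(hR.eq_logistic hρ0 hR0 hq0).1]
    exact hQ.le_logistic hρ0 hq0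
  have hmQ := hQ.le_mass (tendsto_bernstein hν) hq0
  have hmR := hR.le_mass (tendsto_bernstein hνbar) hq0
  -- Both tails are estimated separately. Each mass is at least `Q(q₀) ≥ ρ - 2η`, so mass plus value
  -- at `q₀` minus `ρ` is at least `ρ - 4η ≥ θ`.
  have hfar : 2 * q₀ ≤ q → ∀ l : ℕ, l ≤ 2 →
      q ^ θ * (q ^ l * |expMoment ν l q - expMoment νbar l q|) ≤ 128 * η := by
    intro hqq l hl
    have f1 := rpow_mul_expMoment_le (θ := θ) hν hQ (by linarith) hq0 (η := η) (by linarith) ?_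
      hl hqq
    · have f2 := rpow_mul_expMoment_le (θ := θ) hνbar hR (by linarith) hq0 (η := η) (by linarith) ?_
        hl hqq
      · have n1 : 0 ≤ expMoment ν l q := by
          refine integral_nonneg_of_ae ?_
          filter_upwards [hν] with x hx
          positivity
        have n2 : 0 ≤ expMoment νbar l q := by
          refine integral_nonneg_of_ae ?_
          filter_upwards [hνbar] with x hx
          positivity
        have h3 : |expMoment ν l q - expMoment νbar l q| ≤
            expMoment ν l q + expMoment νbar l q := by
          rw [abs_le]
          constructor <;> linarith
        calc _ ≤ q ^ θ * (q ^ l * (expMoment ν l q + expMoment νbar l q)) := by gcongr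
          _ ≤ _ := by linarith
      · refine le_trans ?_ hσ
        gcongr
    · refine le_trans ?_ hσ
      gcongr
  refine ⟨?_, fun l hl1 hl2 => ?_⟩
  · rcases le_total (2 * q₀) q with hqq | hqq
    · refine (weight_mul_le (by linarith) (by linarith) (by linarith) (abs_nonneg _)
        (hfar hqq 0 (by norm_num))).trans ?_
      linarith
    -- Near `0` the transforms also differ by the difference of the masses; both masses lie in
    -- `[Q(q₀), ρ]`.
    · have h1 : |expMoment ν 0 q - expMoment νbar 0 q| ≤
          (ρ - bernstein ν q₀) + |bernstein νbar q - bernstein ν q| := by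
        rw [expMoment_zero_eq hν hq.le, expMoment_zero_eq hνbar hq.le,
          show ν.real univ - bernstein ν q - (νbar.real univ - bernstein νbar q) =
            (ν.real univ - νbar.real univ) + (bernstein νbar q - bernstein ν q) by ring]
        refine (abs_add_le _ _).trans (add_le_add ?_ le_rfl)
        rw [abs_le]
        constructor <;> linarith
      have h2 : (1 + q) ^ θ ≤ 3 * q₀ ^ θ := by
        calc (1 + q) ^ θ ≤ (3 * q₀) ^ θ := Real.rpow_le_rpow (by linarith) (by linarith) hθ0
          _ = 3 ^ θ * q₀ ^ θ := Real.mul_rpow (by norm_num) hq0.le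
          _ ≤ 3 ^ (1 : ℝ) * q₀ ^ θ := by
              gcongr
              · norm_num
              · linarith
          _ = 3 * q₀ ^ θ := by rw [Real.rpow_one]
      have e : ((0 : ℕ) : ℝ) - ρ - -ρ = 0 := by simp
      rw [e, Real.rpow_zero, mul_one, neg_add_cancel_right]
      have h3 := hH q hq hqq
      calc _ ≤ 3 * q₀ ^ θ * ((ρ - bernstein ν q₀) + |bernstein νbar q - bernstein ν q|) := by
            gcongr
        _ = 3 * (q₀ ^ θ * (ρ - bernstein ν q₀)) +
            3 * (q₀ ^ θ * |bernstein νbar q - bernstein ν q|) := by ring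
        _ ≤ 1024 * η := by linarith
  · rcases le_total (2 * q₀) q with hqq | hqq
    · refine (weight_mul_le (by linarith) (by linarith) (by linarith) (abs_nonneg _)
        (hfar hqq l hl2)).trans ?_
      linarith
    · have h1 : |expMoment ν l q - expMoment νbar l q| ≤ ε * C * q ^ (ρ + κ - l) := by
        rw [abs_sub_comm]
        interval_cases l
        · exact_mod_cast (hcomp' q hq hqq).2.1
        · exact_mod_cast (hcomp' q hq hqq).2.2
      have h2 : (1 + q) ^ (θ + μ + ρ) ≤ (3 * q₀) ^ (θ + μ + ρ) :=
        Real.rpow_le_rpow (by linarith) (by linarith) (by linarith)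
      have e : q ^ ((l : ℝ) - ρ - μ) * q ^ (ρ + κ - l) = q ^ (κ - μ) := by
        rw [← Real.rpow_add hq]
        ring_nf
      have h3 : q ^ (κ - μ) ≤ (2 * q₀) ^ (κ - μ) := Real.rpow_le_rpow hq.le hqq (by linarith)
      calc _ ≤ (3 * q₀) ^ (θ + μ + ρ) * q ^ ((l : ℝ) - ρ - μ) * (ε * C * q ^ (ρ + κ - l)) := by
            gcongr
        _ = ε * C * ((3 * q₀) ^ (θ + μ + ρ) * q ^ (κ - μ)) := by
            rw [← e]
            ring
        _ ≤ ε * C * ((3 * q₀) ^ (θ + μ + ρ) * (2 * q₀) ^ (κ - μ)) := by gcongr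
        _ ≤ 1024 * η := by linarith

/-! ### Regularity of the difference of the Laplace transforms -/

lemma integrable_pow_mul_exp {ν : Measure ℝ} [IsFiniteMeasure ν] (hν : ∀ᵐ x ∂ν, 0 < x) (n : ℕ) :
    ∀ q : ℝ, 0 < q → Integrable (fun x => x ^ n * Real.exp (-(q * x))) ν := by
  induction n with
  | zero => exact fun q hq => integrable_exp_neg_mul hν hq.le
  | succ n ih => exact fun q hq => integrable_pow_succ_mul_exp hν ih hq

lemma contDiffOn_expMoment {ν : Measure ℝ} [IsFiniteMeasure ν] (hν : ∀ᵐ x ∂ν, 0 < x) (k n : ℕ) :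
    ContDiffOn ℝ k (expMoment ν n) (Ioi 0) := by
  have hd : ∀ n : ℕ, ∀ q : ℝ, 0 < q → HasDerivAt (expMoment ν n) (-expMoment ν (n + 1) q) q :=
    fun n q hq => hasDerivAt_expMoment hν (integrable_pow_mul_exp hν n) hq
  induction k generalizing n with
  | zero =>
    exact contDiffOn_zero.2 fun q hq => (hd n q hq).continuousAt.continuousWithinAt
  | succ k ih =>
    rw [Nat.cast_succ, contDiffOn_succ_iff_deriv_of_isOpen isOpen_Ioi]
    refine ⟨fun q hq => (hd n q hq).differentiableAt.differentiableWithinAt, by simp, ?_⟩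
    exact (ih (n + 1)).neg.congr fun q hq => (hd n q hq).deriv

lemma iteratedDeriv_expMoment {ν : Measure ℝ} [IsFiniteMeasure ν] (hν : ∀ᵐ x ∂ν, 0 < x) (l : ℕ) :
    ∀ q : ℝ, 0 < q → iteratedDeriv l (expMoment ν 0) q = (-1) ^ l * expMoment ν l q := by
  induction l with
  | zero => simp
  | succ l ih =>
    intro q hq
    have h : iteratedDeriv l (expMoment ν 0) =ᶠ[nhds q] fun q => (-1) ^ l * expMoment ν l q := by
      filter_upwards [Ioi_mem_nhds hq] with s hs using ih s hs
    rw [iteratedDeriv_succ, h.deriv_eq,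
      ((hasDerivAt_expMoment hν (integrable_pow_mul_exp hν l) hq).const_mul ((-1) ^ l)).deriv]
    ring

lemma laplace_sub_eq {f g : ℝ → ℝ} (hf : IntegrableOn f (Ioi 0)) (hg : IntegrableOn g (Ioi 0))
    {q : ℝ} (hq : 0 ≤ q) : laplace (fun x => f x - g x) q = laplace f q - laplace g q := by
  have hi : ∀ h : ℝ → ℝ, IntegrableOn h (Ioi 0) →
      IntegrableOn (fun x => h x * Real.exp (-(q * x))) (Ioi 0) := by
    intro h hh
    refine Integrable.mono hh (hh.aestronglyMeasurable.mul (by fun_prop)) ?_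
    filter_upwards [ae_restrict_mem measurableSet_Ioi] with x hx
    have hx0 : (0 : ℝ) < x := hx
    rw [norm_mul, Real.norm_of_nonneg (Real.exp_pos _).le]
    refine mul_le_of_le_one_right (norm_nonneg _) ?_
    rw [Real.exp_le_one_iff]
    nlinarith [mul_nonneg hq hx0.le]
  rw [laplace, laplace, laplace, ← integral_sub (hi f hf) (hi g hg)]
  congr 1
  ext x
  ring

lemma norm_two_le {ρ μ θ δ : ℝ} {G : ℝ → ℝ} (hδ : 0 ≤ δ)
    (h0 : ∀ q, 0 < q → (1 + q) ^ (θ + -ρ + ρ) * q ^ (((0 : ℕ) : ℝ) - ρ - -ρ) *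
      |iteratedDeriv 0 G q| ≤ δ / 3)
    (h : ∀ q, 0 < q → ∀ l : ℕ, 1 ≤ l → l ≤ 2 → (1 + q) ^ (θ + μ + ρ) * q ^ ((l : ℝ) - ρ - μ) *
      |iteratedDeriv l G q| ≤ δ / 3) : norm ρ 2 μ θ G ≤ ENNReal.ofReal δ := by
  have s0 : seminorm ρ 0 (-ρ) θ G ≤ ENNReal.ofReal (δ / 3) :=
    iSup₂_le fun q hq => ENNReal.ofReal_le_ofReal (h0 q hq)
  have s : ∀ l : ℕ, 1 ≤ l → l ≤ 2 → seminorm ρ l μ θ G ≤ ENNReal.ofReal (δ / 3) :=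
    fun l hl1 hl2 => iSup₂_le fun q hq => ENNReal.ofReal_le_ofReal (h q hq l hl1 hl2)
  have hsum : ∑ l ∈ Finset.Icc 1 2, seminorm ρ l μ θ G =
      seminorm ρ 1 μ θ G + seminorm ρ 2 μ θ G := by
    rw [Finset.sum_Icc_succ_top (by norm_num)]
    simp
  rw [norm, hsum]
  refine (add_le_add s0 (add_le_add (s 1 le_rfl one_le_two) (s 2 one_le_two le_rfl))).trans ?_
  rw [← ENNReal.ofReal_add (by positivity) (by positivity),
    ← ENNReal.ofReal_add (by positivity) (by positivity)]
  refine ENNReal.ofReal_le_ofReal (le_of_eq ?_)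
  ring

end

end Smoluchowski

/-! ### The theorem -/

open Smoluchowski in
theorem proposition3p6 (α ρ θ : ℝ) (hα : 0 ≤ α) (hρ : ρ ∈ Set.Ioo (0 : ℝ) 1)
    (hθ : θ ∈ Set.Ioo α (min ρ (1 / 2)))
    (W : ℝ → ℝ → ℝ) (hW : Smoluchowski.IsPerturbationKernel α W)
    (fbar : ℝ → ℝ)
    (hfbar : Smoluchowski.IsSelfSimilarProfile ρ 0 Smoluchowski.constantKernel fbar)
    (hfbar_norm : Smoluchowski.IsNormalised ρ fbar)
    (μ : ℝ) (hμ : μ ∈ Set.Ico 0 (min ρ (1 - ρ))) (δ : ℝ) (hδ : 0 < δ) :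
    ∃ ε₀ : ℝ, 0 < ε₀ ∧ ∀ ε : ℝ, 0 < ε → ε ≤ ε₀ → ∀ f : ℝ → ℝ,
      Smoluchowski.IsSelfSimilarProfile ρ α (Smoluchowski.coagulationKernel ε W) f →
      Smoluchowski.IsNormalised ρ f →
        MeasureTheory.IntegrableOn f (Set.Ioi 0) ∧
        MeasureTheory.IntegrableOn fbar (Set.Ioi 0) ∧
        Smoluchowski.laplace (fun x => f x - fbar x) ∈ Smoluchowski.space ρ 2 μ θ ∧
        Smoluchowski.norm ρ 2 μ θ (Smoluchowski.laplace (fun x => f x - fbar x)) ≤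
          ENNReal.ofReal δ := by
  obtain ⟨hρ0, hρ1⟩ := hρ
  obtain ⟨hαθ, hθ'⟩ := hθ
  have hθρ : θ < ρ := (lt_min_iff.1 hθ').1
  -- `3072 = 3 · 1024`: each of the three terms of the norm receives `δ / 3`. The second entry
  -- secures the decay exponent `θ` of the tails.
  set η : ℝ := min (δ / 3072) ((ρ - θ) / 4) with hη
  have hη0 : 0 < η := lt_min (by positivity) (by linarith)
  have hη1 : 4 * η ≤ ρ - θ := by
    have := min_le_right (δ / 3072) ((ρ - θ) / 4)
    linarith
  have hη2 : 1024 * η ≤ δ / 3 := by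
    have := min_le_left (δ / 3072) ((ρ - θ) / 4)
    linarith
  obtain ⟨ε₀, hε₀, hclose⟩ := exists_moments_close hα hρ0 hρ1 (hαθ.trans hθρ) (hα.trans hαθ.le)
    hμ hW hfbar hfbar_norm hη0 hη1
  refine ⟨ε₀, hε₀, fun ε hε hεε f hf hn => ?_⟩
  have hbound := hclose ε hε hεε f hf hn
  have hlt : particleMeasure f Set.univ < ⊤ :=
    (measure_univ_particleMeasure_le hρ0 hρ1 hε.le hW hf hn).trans_lt ENNReal.ofReal_lt_top
  have hfbar' := hfbar
  rw [← coagulationKernel_zero] at hfbar'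
  have hltbar : particleMeasure fbar Set.univ < ⊤ :=
    (measure_univ_particleMeasure_le hρ0 hρ1 le_rfl isPerturbationKernel_zero hfbar'
      hfbar_norm).trans_lt ENNReal.ofReal_lt_top
  have : MeasureTheory.IsFiniteMeasure (particleMeasure f) := ⟨hlt⟩
  have : MeasureTheory.IsFiniteMeasure (particleMeasure fbar) := ⟨hltbar⟩
  have hint := integrableOn_of_measure_univ_lt_top hf.locallyIntegrableOn hf.nonneg hlt
  have hintbar := integrableOn_of_measure_univ_lt_top hfbar.locallyIntegrableOn hfbar.nonneg hltbar
  have hν := ae_pos_particleMeasure f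
  have hνbar := ae_pos_particleMeasure fbar
  have hG : ∀ q : ℝ, 0 ≤ q → laplace (fun x => f x - fbar x) q =
      expMoment (particleMeasure f) 0 q - expMoment (particleMeasure fbar) 0 q := by
    intro q hq
    rw [laplace_sub_eq hint hintbar hq, laplace_eq_expMoment hf.locallyIntegrableOn hf.nonneg,
      laplace_eq_expMoment hfbar.locallyIntegrableOn hfbar.nonneg]
  have hGd : ∀ l : ℕ, ∀ q : ℝ, 0 < q →
      |iteratedDeriv l (laplace (fun x => f x - fbar x)) q| =
        |expMoment (particleMeasure f) l q - expMoment (particleMeasure fbar) l q| := by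
    intro l q hq
    -- The formula for the transform holds only for `q ≥ 0`, but iterated derivatives at `q > 0`
    -- depend only on the germ.
    have h1 : laplace (fun x => f x - fbar x) =ᶠ[nhds q]
        expMoment (particleMeasure f) 0 - expMoment (particleMeasure fbar) 0 := by
      filter_upwards [Ioi_mem_nhds hq] with s hs using hG s (le_of_lt hs)
    rw [h1.iteratedDeriv_eq, iteratedDeriv_sub
      ((contDiffOn_expMoment hν l 0).contDiffAt (Ioi_mem_nhds hq))
      ((contDiffOn_expMoment hνbar l 0).contDiffAt (Ioi_mem_nhds hq)),
      iteratedDeriv_expMoment hν l q hq, iteratedDeriv_expMoment hνbar l q hq, ← mul_sub, abs_mul,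
      abs_pow, abs_neg, abs_one, one_pow, one_mul]
  have hnorm : norm ρ 2 μ θ (laplace (fun x => f x - fbar x)) ≤ ENNReal.ofReal δ := by
    refine norm_two_le hδ.le (fun q hq => ?_) (fun q hq l hl1 hl2 => ?_)
    · rw [hGd 0 q hq]
      exact (hbound q hq).1.trans hη2
    · rw [hGd l q hq]
      exact ((hbound q hq).2 l hl1 hl2).trans hη2
  refine ⟨hint, hintbar, ⟨?_, ?_, hnorm.trans_lt ENNReal.ofReal_lt_top⟩, hnorm⟩
  · exact ((contDiffOn_expMoment hν 2 0).sub (contDiffOn_expMoment hνbar 2 0)).congr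
      fun q hq => hG q (le_of_lt hq)
  · exact ((continuousOn_expMoment_zero hν).sub (continuousOn_expMoment_zero hνbar)).congr
      fun q hq => hG q hq
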